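/- Let $l\ge 1$, let $q_1\ge q_2\ge\dots\ge q_l\ge 0$ be integers, $N=q_1+\dots+q_l$, and $k\in\mathbb C$. For $1\le i\le N$ let $\mathrm{col}(i)=s$ if $q_1+\dots+q_{s-1}<i\le q_1+\dots+q_s$, and $\mathrm{row}(i)=i-(q_1+\dots+q_{\mathrm{col}(i)-1})$. Let $\hat i$ (resp. $\tilde i$) be the index with the same row as $i$ and column $\mathrm{col}(i)+1$ (resp. $\mathrm{col}(i)-1$), if it exists. Put $\alpha_s=k+N-q_s$ and $\gamma_a=\sum_{u=a+1}^{l}\alpha_u$. Let $\mathfrak b=\bigoplus_{\mathrm{col}(i)\ge\mathrm{col}(j)}\mathbb C e_{i,j}\subset\mathfrak{gl}(N)$ with the invariant form $$\kappa(e_{i,j},e_{p,r})=\alpha_{\mathrm{col}(i)}\delta_{i,r}\delta_{j,p}+\delta_{\mathrm{col}(i),\mathrm{col}(p)}\delta_{i,j}\delta_{p,r},$$ and let $\mathfrak a=\mathfrak b\oplus\bigoplus_{\mathrm{col}(i)>\mathrm{col}(j)}\mathbb C\psi_{i,j}$ be the Lie superalgebra with even part $\mathfrak b$, odd elements $\psi_{i,j}$,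 and $[e_{i,j},\psi_{p,r}]=\delta_{j,p}\psi_{i,r}-\delta_{i,r}\psi_{p,j}$, $[\psi_{i,j},\psi_{p,r}]=0$, with the form $\tilde\kappa$ extending $\kappa$ by zero. Let $V^\kappa(\mathfrak b)$ and $V^{\tilde\kappa}(\mathfrak a)$ be the universal affine vertex (super)algebras; write $u[-s]=ut^{-s}|0\rangle$, and let juxtaposition denote the product $x_{(-1)}y$. Let $d_0\colon V^\kappa(\mathfrak b)\to V^{\tilde\kappa}(\mathfrak a)$ be the odd derivation (of all $n$-th products) with $d_0|0\rangle=0$, $[d_0,\partial]=0$ and $$d_0(e_{i,j}[-1])=\sum_{\mathrm{col}(i)>\mathrm{col}(r)\ge\mathrm{col}(j)}e_{r,j}[-1]\psi_{i,r}[-1]-\sum_{\mathrm{col}(j)<\mathrm{col}(r)\le\mathrm{col}(i)}\psi_{r,j}[-1]e_{i,r}[-1]+\delta(\mathrm{col}(i)>\mathrm{col}(j))\,\alpha_{\mathrm{col}(i)}\psi_{i,j}[-2]+\psi_{\hat i,j}[-1]-\psi_{i,\tilde j}[-1],$$ where terms with a non-existing $\hat i$ or $\tilde j$ are omitted. The $W$-algebra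 is $\mathcal W^k(\mathfrak{gl}(N),f)=\{y\in V^\kappa(\mathfrak b)\mid d_0(y)=0\}$, where $f=\sum_j e_{\hat j,j}$. Define $$W^{(1)}_{p,r}=\sum_{\substack{\mathrm{row}(i)=p,\ \mathrm{row}(j)=r\\ \mathrm{col}(i)=\mathrm{col}(j)}}e_{i,j}[-1]\qquad\text{for } q_l<p=r\le q_1\ \text{ or }\ 1\le p,r\le q_l,$$ and, for $1\le p,r\le q_l$, $$W^{(2)}_{p,r}=\sum_{\substack{\mathrm{col}(i)=\mathrm{col}(j)+1\\ \mathrm{row}(i)=p,\ \mathrm{row}(j)=r}}e_{i,j}[-1]-\sum_{\substack{\mathrm{col}(i)=\mathrm{col}(j)\\ \mathrm{row}(i)=p,\ \mathrm{row}(j)=r}}\gamma_{\mathrm{col}(i)}e_{i,j}[-2]+\sum_{\substack{\mathrm{col}(u)=\mathrm{col}(j)<\mathrm{col}(i)=\mathrm{col}(v)\\ \mathrm{row}(u)=\mathrm{row}(v)\le q_l\\ \mathrm{row}(i)=p,\ \mathrm{row}(j)=r}}e_{u,j}[-1]e_{i,v}[-1]-\sum_{\substack{\mathrm{col}(u)=\mathrm{col}(j)\ge\mathrm{col}(i)=\mathrm{col}(v)\\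 \mathrm{row}(u)=\mathrm{row}(v)>q_l\\ \mathrm{row}(i)=p,\ \mathrm{row}(j)=r}}e_{u,j}[-1]e_{i,v}[-1].$$ Then all these elements $W^{(1)}_{p,r}$ and $W^{(2)}_{p,r}$ lie in $\mathcal W^k(\mathfrak{gl}(N),f)$, that is, $d_0(W^{(1)}_{p,r})=0$ and $d_0(W^{(2)}_{p,r})=0$. -/

import Mathlib

/-! The definitions come in three blocks: affine vertex superalgebras, the pyramid and its Lie
(super)algebras, and the modes of the image of `e_{i,j}[-1]` under the differential (first part);
the differential `dZero`, the `W`-algebra `WAlgebra` and the elements `W1`, `W2` (last section).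
Everything in between proves that the differential is well defined. -/

noncomputable section

namespace WAlg

/-! ### Universal affine vertex superalgebras

A Lie superalgebra is given by a homogeneous basis `B`, the parity `odd` of the basis elements,
the superbracket `br` of two basis elements, and an invariant supersymmetric form `form`. -/

section Affine

variable {B : Type} (odd : B → Bool) (br : B → B → B →₀ ℂ) (form : B → B → ℂ)

/-- The defining relations of the enveloping superalgebra of the affinization, at central
charge one:
`[x tᵐ, y tⁿ] = [x, y] tᵐ⁺ⁿ + m δ_{m+n,0} form(x, y)`, where the left-hand side is the
supercommutator. The generator `(x, m)` stands for `x tᵐ`. -/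
inductive AffineRel : FreeAlgebra ℂ (B × ℤ) → FreeAlgebra ℂ (B × ℤ) → Prop
  | comm (x y : B) (m n : ℤ) : AffineRel
      (FreeAlgebra.ι ℂ (x, m) * FreeAlgebra.ι ℂ (y, n)
        - (if odd x && odd y then (-1 : ℂ) else 1) •
          (FreeAlgebra.ι ℂ (y, n) * FreeAlgebra.ι ℂ (x, m)))
      (Finsupp.linearCombination ℂ (fun z => FreeAlgebra.ι ℂ (z, m + n)) (br x y)
        + algebraMap ℂ _ (if m + n = 0 then m * form x y else 0))

/-- The enveloping superalgebra of the affinization, with the central element set to `1`. -/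
def ModeAlgebra : Type := RingQuot (AffineRel odd br form)

instance : Ring (ModeAlgebra odd br form) := inferInstanceAs (Ring (RingQuot _))

instance : Algebra ℂ (ModeAlgebra odd br form) := inferInstanceAs (Algebra ℂ (RingQuot _))

/-- The projection from the free algebra on the symbols `x tⁿ`. -/
def ofFree : FreeAlgebra ℂ (B × ℤ) →ₐ[ℂ] ModeAlgebra odd br form :=
  RingQuot.mkAlgHom ℂ (AffineRel odd br form)

/-- The element `x tⁿ` for a basis element `x`. -/
def mode (x : B) (n : ℤ) : ModeAlgebra odd br form :=
  ofFree odd br form (FreeAlgebra.ι ℂ (x, n))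

/-- The element `u tⁿ` for an arbitrary element `u` of the Lie superalgebra. -/
def current (u : B →₀ ℂ) (n : ℤ) : ModeAlgebra odd br form :=
  Finsupp.linearCombination ℂ (fun z => mode odd br form z n) u

/-- The left ideal generated by all `x tⁿ` with `n ≥ 0`. -/
def vacuumIdeal : Submodule (ModeAlgebra odd br form) (ModeAlgebra odd br form) :=
  Submodule.span _ {a | ∃ (x : B) (n : ℤ), 0 ≤ n ∧ a = mode odd br form x n}

/-- The universal affine vertex superalgebra, as the vacuum module of the affinization. -/
abbrev UniversalAffine : Type := ModeAlgebra odd br form ⧸ vacuumIdeal odd br form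

/-- The vacuum vector. -/
def vac : UniversalAffine odd br form := Submodule.Quotient.mk 1

end Affine

/-- The `n`-th mode `(x₍₋₁₎y)₍ₙ₎` of the normally ordered product of two fields, at least one of
which is even, acting on a vector:
`∑_{j<0} x₍ⱼ₎ y₍ₙ₋₁₋ⱼ₎ + ∑_{j≥0} y₍ₙ₋₁₋ⱼ₎ x₍ⱼ₎`. -/
def normalMode {A M : Type*} [Ring A] [AddCommGroup M] [Module A M]
    (x y : ℤ → A) (n : ℤ) (v : M) : M :=
  ∑ᶠ j : ℤ, if j < 0 then x j • y (n - 1 - j) • v else y (n - 1 - j) • x j • v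

/-! ### The pyramid, the Lie algebra `𝔟` and the Lie superalgebra `𝔞` -/

/-- The index set `{1, …, N}`, `N = q₁ + ⋯ + q_l`, an index being identified with the box of the
pyramid with column heights `q₁, …, q_l` in its column and row. -/
abbrev Box {l : ℕ} (q : Fin l → ℕ) : Type := Σ s : Fin l, Fin (q s)

section Pyramid

variable {l : ℕ} {q : Fin l → ℕ}

/-- The column of a box. -/
abbrev col (i : Box q) : Fin l := i.1

/-- The row of a box; rows are numbered from `1`. -/
abbrev row (i : Box q) : ℕ := i.2 + 1

/-- `h = î`, equivalently `i = h̃`: the box `h` is in the row of `i`, one column further. -/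
def RightOf (h i : Box q) : Prop := row h = row i ∧ (col h : ℕ) = col i + 1

instance (h i : Box q) : Decidable (RightOf h i) := inferInstanceAs (Decidable (_ ∧ _))

/-- `α_s = k + N - q_s`. -/
def alpha (q : Fin l → ℕ) (k : ℂ) (s : Fin l) : ℂ := k + ((∑ t, q t : ℕ) : ℂ) - q s

/-- `γ_a = ∑_{u>a} α_u`. -/
def gamma (q : Fin l → ℕ) (k : ℂ) (a : Fin l) : ℂ := ∑ u : Fin l with a < u, alpha q k u

/-- `κ(e_{a,b}, e_{i,j}) = α_{col a} δ_{a,j} δ_{i,b} + δ_{col a,col i} δ_{a,b} δ_{i,j}`. -/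
def formB (α : Fin l → ℂ) (a b i j : Box q) : ℂ :=
  (if b = i ∧ a = j then α (col a) else 0) + (if a = b ∧ i = j ∧ col a = col i then 1 else 0)

variable (q)

/-- The basis `e_{i,j}`, `col i ≥ col j`, of `𝔟`. -/
abbrev BasisB : Type := {x : Box q × Box q // col x.2 ≤ col x.1}

/-- The basis `e_{i,j}`, `col i ≥ col j`, and `ψ_{i,j}`, `col i > col j`, of `𝔞`. -/
abbrev BasisA : Type := BasisB q ⊕ {x : Box q × Box q // col x.2 < col x.1}

variable {q}

/-- `e_{i,j}` as an element of `𝔟` (zero if `e_{i,j}` is not in `𝔟`). -/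
def eB (i j : Box q) : BasisB q →₀ ℂ :=
  if h : col j ≤ col i then Finsupp.single ⟨(i, j), h⟩ 1 else 0

/-- `e_{i,j}` as an element of `𝔞` (zero if `e_{i,j}` is not in `𝔟`). -/
def eA (i j : Box q) : BasisA q →₀ ℂ :=
  if h : col j ≤ col i then Finsupp.single (Sum.inl ⟨(i, j), h⟩) 1 else 0

/-- `ψ_{i,j}` as an element of `𝔞` (zero unless `col i > col j`). -/
def psiA (i j : Box q) : BasisA q →₀ ℂ :=
  if h : col j < col i then Finsupp.single (Sum.inr ⟨(i, j), h⟩) 1 else 0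

/-- `𝔟` is purely even. -/
def oddB (_ : BasisB q) : Bool := false

/-- `[e_{i,j}, e_{p,r}] = δ_{j,p} e_{i,r} - δ_{i,r} e_{p,j}`. -/
def brB (x y : BasisB q) : BasisB q →₀ ℂ :=
  (if x.1.2 = y.1.1 then eB x.1.1 y.1.2 else 0) - (if x.1.1 = y.1.2 then eB y.1.1 x.1.2 else 0)

/-- The form `κ` on `𝔟`. -/
def kappaB (q : Fin l → ℕ) (k : ℂ) (x y : BasisB q) : ℂ :=
  formB (alpha q k) x.1.1 x.1.2 y.1.1 y.1.2

/-- The `e_{i,j}` are even and the `ψ_{i,j}` are odd. -/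
def oddA : BasisA q → Bool
  | Sum.inl _ => false
  | Sum.inr _ => true

/-- The superbracket of `𝔞`: that of `𝔟`, together with
`[e_{i,j}, ψ_{p,r}] = δ_{j,p} ψ_{i,r} - δ_{i,r} ψ_{p,j} = -[ψ_{p,r}, e_{i,j}]` and `[ψ, ψ] = 0`. -/
def brA : BasisA q → BasisA q → BasisA q →₀ ℂ
  | Sum.inl x, Sum.inl y => (if x.1.2 = y.1.1 then eA x.1.1 y.1.2 else 0)
      - (if x.1.1 = y.1.2 then eA y.1.1 x.1.2 else 0)
  | Sum.inl x, Sum.inr y => (if x.1.2 = y.1.1 then psiA x.1.1 y.1.2 else 0)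
      - (if x.1.1 = y.1.2 then psiA y.1.1 x.1.2 else 0)
  | Sum.inr y, Sum.inl x => (if x.1.1 = y.1.2 then psiA y.1.1 x.1.2 else 0)
      - (if x.1.2 = y.1.1 then psiA x.1.1 y.1.2 else 0)
  | Sum.inr _, Sum.inr _ => 0

/-- The form `κ̃` on `𝔞`, extending `κ` by zero. -/
def kappaA (q : Fin l → ℕ) (k : ℂ) : BasisA q → BasisA q → ℂ
  | Sum.inl x, Sum.inl y => kappaB q k x y
  | _, _ => 0

variable (q) (k : ℂ)

/-- The enveloping algebra acting on `V^κ(𝔟)`. -/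
abbrev AlgB : Type := ModeAlgebra (oddB (q := q)) brB (kappaB q k)

/-- The enveloping superalgebra acting on `V^κ̃(𝔞)`. -/
abbrev AlgA : Type := ModeAlgebra (oddA (q := q)) brA (kappaA q k)

/-- `V^κ(𝔟)`. -/
abbrev VB : Type := UniversalAffine (oddB (q := q)) brB (kappaB q k)

/-- `V^κ̃(𝔞)`. -/
abbrev VA : Type := UniversalAffine (oddA (q := q)) brA (kappaA q k)

/-- The vacuum vector of `V^κ(𝔟)`. -/
abbrev vacB : VB q k := vac oddB brB (kappaB q k)

/-- The vacuum vector of `V^κ̃(𝔞)`. -/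
abbrev vacA : VA q k := vac oddA brA (kappaA q k)

variable {q}

/-- The mode `e_{i,j} tⁿ`, acting on `V^κ(𝔟)`. -/
def modeB (i j : Box q) (n : ℤ) : AlgB q k := current oddB brB (kappaB q k) (eB i j) n

/-- The mode `e_{i,j} tⁿ`, acting on `V^κ̃(𝔞)`. -/
def modeE (i j : Box q) (n : ℤ) : AlgA q k := current oddA brA (kappaA q k) (eA i j) n

/-- The mode `ψ_{i,j} tⁿ`, acting on `V^κ̃(𝔞)`. -/
def modePsi (i j : Box q) (n : ℤ) : AlgA q k := current oddA brA (kappaA q k) (psiA i j) n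

end Pyramid

/-! ### The differential -/

/-- Given the modes of the fields `e_{i,j}` and `ψ_{i,j}`, the action on a vector of the `n`-th mode
of the field
`∑_{col i > col r ≥ col j} e_{r,j}[-1] ψ_{i,r}[-1] - ∑_{col j < col r ≤ col i} ψ_{r,j}[-1] e_{i,r}[-1]
  + δ(col i > col j) α_{col i} ψ_{i,j}[-2] + ψ_{î,j}[-1] - ψ_{i,j̃}[-1]`.
The `n`-th mode of `ψ[-2] = ∂ψ` is `-n ψ₍ₙ₋₁₎`; terms with a non-existing `î` or `j̃` are zero. -/
def diffMode {l : ℕ} {q : Fin l → ℕ} {A M : Type*} [Ring A] [AddCommGroup M] [Module A M]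
    [Module ℂ M] (E P : Box q → Box q → ℤ → A) (α : Fin l → ℂ) (i j : Box q) (n : ℤ) (v : M) : M :=
  (∑ r : Box q with col j ≤ col r ∧ col r < col i, normalMode (E r j) (P i r) n v)
  - (∑ r : Box q with col j < col r ∧ col r ≤ col i, normalMode (P r j) (E i r) n v)
  + (if col j < col i then α (col i) • (-(n : ℂ)) • P i j (n - 1) • v else 0)
  + (∑ h : Box q with RightOf h i, P h j n • v) - ∑ h : Box q with RightOf j h, P i h n • v

/-! The following facts show that the differential is well defined. -/

section NormalOrder
variable {A M : Type*} [Ring A] [AddCommGroup M] [Module A M]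

/-- Auxiliary: `normalMode` with the ordering cut at `c` in place of `0`. -/
def cutMode (x y : ℤ → A) (c n : ℤ) (v : M) : M :=
  ∑ᶠ j : ℤ, if j < c then x j • y (n - 1 - j) • v else y (n - 1 - j) • x j • v

variable (M) in
/-- Auxiliary: the modes of large index annihilate any given vector. -/
def Truncated (x : ℤ → A) : Prop := ∀ v : M, ∃ K : ℤ, ∀ n, K ≤ n → x n • v = 0

theorem Truncated.zero : Truncated M (0 : ℤ → A) := fun v => ⟨0, by simp⟩

theorem Truncated.add {x y : ℤ → A} (hx : Truncated M x) (hy : Truncated M y) : Truncated M (x + y) := by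
  intro v
  obtain ⟨K, hK⟩ := hx v
  obtain ⟨L, hL⟩ := hy v
  exact ⟨max K L, fun n hn => by
    simp [add_smul, hK n (le_trans (le_max_left _ _) hn), hL n (le_trans (le_max_right _ _) hn)]⟩

theorem Truncated.neg {x : ℤ → A} (hx : Truncated M x) : Truncated M (-x) := by
  intro v
  obtain ⟨K, hK⟩ := hx v
  exact ⟨K, fun n hn => by simp [hK n hn]⟩

theorem Truncated.sub {x y : ℤ → A} (hx : Truncated M x) (hy : Truncated M y) : Truncated M (x - y) := by
  rw [sub_eq_add_neg]; exact hx.add hy.neg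

theorem cutMode_finite {x y : ℤ → A} (hx : Truncated M x) (hy : Truncated M y) (c n : ℤ) (v : M) :
    (Function.support fun j : ℤ =>
      if j < c then x j • y (n - 1 - j) • v else y (n - 1 - j) • x j • v).Finite := by
  obtain ⟨K, hK⟩ := hx v
  obtain ⟨L, hL⟩ := hy v
  refine (Set.finite_Icc (min c (n - 1 - L)) (max c K)).subset fun j hj => ?_
  simp only [Function.mem_support] at hj
  by_contra hc
  apply hj
  simp only [Set.mem_Icc, not_and_or, not_le] at hc
  split_ifs with h
  · rw [hL (n - 1 - j) (by grind), smul_zero]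
  · rw [hK j (by grind), smul_zero]

theorem cutMode_add {x y : ℤ → A} (hx : Truncated M x) (hy : Truncated M y) (c n : ℤ) (v w : M) :
    cutMode x y c n (v + w) = cutMode x y c n v + cutMode x y c n w := by
  unfold cutMode
  rw [← finsum_add_distrib (cutMode_finite hx hy c n v) (cutMode_finite hx hy c n w)]
  refine finsum_congr fun j => ?_
  split_ifs <;> simp

theorem cutMode_smul [Algebra ℂ A] [Module ℂ M] [IsScalarTower ℂ A M] {x y : ℤ → A}
    (hx : Truncated M x) (hy : Truncated M y) (c n : ℤ) (t : ℂ) (v : M) :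
    cutMode x y c n (t • v) = t • cutMode x y c n v := by
  unfold cutMode
  refine Eq.trans (finsum_congr fun j => ?_)
    ((DistribSMul.toAddMonoidHom M t).map_finsum (cutMode_finite hx hy c n v)).symm
  have hs : ∀ (a : A) (w : M), a • t • w = t • a • w := fun a w => smul_algebra_smul_comm _ _ _
  simp only [DistribSMul.toAddMonoidHom_apply]
  split_ifs <;> simp only [hs]

theorem cutMode_add_left {x x' y : ℤ → A} (hx : Truncated M x) (hx' : Truncated M x')
    (hy : Truncated M y) (c n : ℤ) (v : M) :
    cutMode (x + x') y c n v = cutMode x y c n v + cutMode x' y c n v := by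
  unfold cutMode
  rw [← finsum_add_distrib (cutMode_finite hx hy c n v) (cutMode_finite hx' hy c n v)]
  refine finsum_congr fun j => ?_
  split_ifs <;> simp [add_smul]

theorem cutMode_add_right {x y y' : ℤ → A} (hx : Truncated M x) (hy : Truncated M y)
    (hy' : Truncated M y') (c n : ℤ) (v : M) :
    cutMode x (y + y') c n v = cutMode x y c n v + cutMode x y' c n v := by
  unfold cutMode
  rw [← finsum_add_distrib (cutMode_finite hx hy c n v) (cutMode_finite hx hy' c n v)]
  refine finsum_congr fun j => ?_
  split_ifs <;> simp [add_smul]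

theorem cutMode_neg_left (x y : ℤ → A) (c n : ℤ) (v : M) :
    cutMode (-x) y c n v = - cutMode x y c n v := by
  unfold cutMode
  rw [← finsum_neg_distrib]
  refine finsum_congr fun j => ?_
  split_ifs <;> simp

theorem cutMode_neg_right (x y : ℤ → A) (c n : ℤ) (v : M) :
    cutMode x (-y) c n v = - cutMode x y c n v := by
  unfold cutMode
  rw [← finsum_neg_distrib]
  refine finsum_congr fun j => ?_
  split_ifs <;> simp

theorem cutMode_zero_left (y : ℤ → A) (c n : ℤ) (v : M) : cutMode 0 y c n v = 0 := by
  simp [cutMode]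

theorem cutMode_zero_right (x : ℤ → A) (c n : ℤ) (v : M) : cutMode x 0 c n v = 0 := by
  simp [cutMode]

theorem cutMode_succ {x y w : ℤ → A} (hx : Truncated M x) (hy : Truncated M y)
    (h : ∀ i j, x i * y j - y j * x i = w (i + j)) (c n : ℤ) (v : M) :
    cutMode x y (c + 1) n v = cutMode x y c n v + w (n - 1) • v := by
  rw [← sub_eq_iff_eq_add']
  unfold cutMode
  rw [← finsum_sub_distrib (cutMode_finite hx hy (c + 1) n v) (cutMode_finite hx hy c n v),
    finsum_eq_single _ c]
  · have := congrArg (· • v) (h c (n - 1 - c))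
    simp only [sub_smul, mul_smul] at this
    rw [if_pos (by omega), if_neg (by omega), this]
    congr 2; ring
  · intro j hj
    rcases lt_or_gt_of_ne hj with h1 | h1
    · rw [if_pos (by omega), if_pos h1, sub_self]
    · rw [if_neg (by omega), if_neg (by omega), sub_self]

theorem cutMode_eq {x y w : ℤ → A} (hx : Truncated M x) (hy : Truncated M y)
    (h : ∀ i j, x i * y j - y j * x i = w (i + j)) (c n : ℤ) (v : M) :
    cutMode x y c n v = cutMode x y 0 n v + c • w (n - 1) • v := by
  induction c using Int.induction_on with
  | zero => simp
  | succ c ih => rw [cutMode_succ hx hy h, ih, add_smul, one_smul, add_assoc]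
  | pred c ih =>
    have := cutMode_succ hx hy h (-(c : ℤ) - 1) n v
    rw [sub_add_cancel, ih] at this
    rw [sub_smul, one_smul, ← add_sub_assoc, this, add_sub_cancel_right]

theorem normalMode_flip {x y w : ℤ → A} (hx : Truncated M x) (hy : Truncated M y)
    (h : ∀ i j, x i * y j - y j * x i = w (i + j)) (n : ℤ) (v : M) :
    normalMode y x n v = cutMode x y 0 n v + n • w (n - 1) • v := by
  rw [← cutMode_eq hx hy h]
  unfold normalMode cutMode
  rw [← finsum_comp_equiv (Equiv.subLeft (n - 1))]
  refine finsum_congr fun j => ?_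
  simp only [Equiv.subLeft_apply, sub_sub_cancel]
  by_cases hj : j < n
  · rw [if_pos hj, if_neg (by omega)]
  · rw [if_neg hj, if_pos (by omega)]

theorem cutMode_comm {z : A} {x y x' y' : ℤ → A} {m : ℤ} {t : A}
    (hx : Truncated M x) (hy : Truncated M y) (hx' : Truncated M x') (hy' : Truncated M y')
    (hzx : ∀ j, z * x j - x j * z = x' (m + j) + if m + j = 0 then t else 0)
    (hzy : ∀ j, z * y j - y j * z = y' (m + j))
    (ht : ∀ j, t * y j = y j * t) (n : ℤ) (v : M) :
    z • cutMode x y 0 n v - cutMode x y 0 n (z • v) =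
      cutMode x' y m (m + n) v + cutMode x y' 0 (m + n) v + t • y (m + n - 1) • v := by
  have e1 : cutMode x' y m (m + n) v = ∑ᶠ j : ℤ, if j < 0 then x' (m + j) • y (n - 1 - j) • v
      else y (n - 1 - j) • x' (m + j) • v := by
    unfold cutMode
    rw [← finsum_comp_equiv (Equiv.addLeft m)]
    refine finsum_congr fun j => ?_
    simp only [Equiv.coe_addLeft, show m + n - 1 - (m + j) = n - 1 - j by ring,
      show (m + j < m) ↔ j < 0 by omega]
  have f1 : (Function.support fun j : ℤ => if j < 0 then x' (m + j) • y (n - 1 - j) • v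
      else y (n - 1 - j) • x' (m + j) • v).Finite := by
    have := (cutMode_finite hx' hy m (m + n) v).preimage
      (Equiv.addLeft m).injective.injOn
    refine this.subset fun j hj => ?_
    simpa only [Set.mem_preimage, Function.mem_support, Equiv.coe_addLeft,
      show m + n - 1 - (m + j) = n - 1 - j by ring, show (m + j < m) ↔ j < 0 by omega] using hj
  have e2 : t • y (m + n - 1) • v =
      ∑ᶠ j : ℤ, if m + j = 0 then t • y (n - 1 - j) • v else 0 := by
    rw [finsum_eq_single _ (-m)]
    · rw [if_pos (by ring)]; congr 3; ring
    · intro j hj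
      rw [if_neg (by omega)]
  have f2 : (Function.support fun j : ℤ => if m + j = 0 then t • y (n - 1 - j) • v else 0).Finite := by
    refine (Set.finite_singleton (-m)).subset fun j hj => ?_
    simp only [Function.mem_support, ne_eq, ite_eq_right_iff, Classical.not_imp] at hj
    simp only [Set.mem_singleton_iff]; omega
  have e3 : z • cutMode x y 0 n v = ∑ᶠ j : ℤ, z • (if j < 0 then x j • y (n - 1 - j) • v
      else y (n - 1 - j) • x j • v) := by
    unfold cutMode
    exact ((DistribSMul.toAddMonoidHom M z).map_finsum (cutMode_finite hx hy 0 n v))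
  have f3 : (Function.support fun j : ℤ => z • (if j < 0 then x j • y (n - 1 - j) • v
      else y (n - 1 - j) • x j • v)).Finite := by
    refine (cutMode_finite hx hy 0 n v).subset fun j hj hj' => hj ?_
    exact (congrArg (z • ·) hj').trans (smul_zero z)
  have f4 := cutMode_finite hx hy 0 n (z • v)
  have f5 := cutMode_finite hx hy' 0 (m + n) v
  rw [e1, e2, e3]
  unfold cutMode
  rw [← finsum_sub_distrib f3 f4, ← finsum_add_distrib f1 f5, ← finsum_add_distrib _ f2]
  · refine finsum_congr fun j => ?_
    have a1 := congrArg (fun u : A => u • y (n - 1 - j) • v) (hzx j)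
    have a2 := congrArg (fun u : A => x j • u • v) (hzy (n - 1 - j))
    have b1 := congrArg (fun u : A => y (n - 1 - j) • u • v) (hzx j)
    have b2 := congrArg (fun u : A => u • x j • v) (hzy (n - 1 - j))
    have c1 := congrArg (fun u : A => u • v) (ht (n - 1 - j))
    simp only [sub_smul, mul_smul, smul_sub, add_smul, smul_add] at a1 a2 b1 b2 c1
    rw [show m + (n - 1 - j) = m + n - 1 - j by ring] at a2 b2
    by_cases hj : j < 0
    · simp only [if_pos hj]
      have : z • x j • y (n - 1 - j) • v - x j • y (n - 1 - j) • z • v =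
        (z • x j • y (n - 1 - j) • v - x j • z • y (n - 1 - j) • v) +
        (x j • z • y (n - 1 - j) • v - x j • y (n - 1 - j) • z • v) := by abel
      rw [this, a1, a2]
      split_ifs
      · abel
      · simp only [add_zero, zero_smul]
    · simp only [if_neg hj]
      have : z • y (n - 1 - j) • x j • v - y (n - 1 - j) • x j • z • v =
        (z • y (n - 1 - j) • x j • v - y (n - 1 - j) • z • x j • v) +
        (y (n - 1 - j) • z • x j • v - y (n - 1 - j) • x j • z • v) := by abel
      rw [this, b1, b2]
      split_ifs
      · rw [c1]; abel
      · rw [add_zero, zero_smul, smul_zero, add_zero]; abel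
  · exact (f1.union f5).subset (Function.support_add _ _)

end NormalOrder

section Key
variable {l : ℕ} {q : Fin l → ℕ} {M : Type*} [AddCommGroup M]

theorem ite_add_ite {p p₁ p₂ : Prop} [Decidable p] [Decidable p₁] [Decidable p₂] (x : M)
    (h : p ↔ p₁ ∨ p₂) (h' : ¬ (p₁ ∧ p₂)) :
    (if p₁ then x else 0) + (if p₂ then x else 0) = if p then x else 0 := by
  by_cases h1 : p₁ <;> by_cases h2 : p₂ <;> simp_all

theorem cut_le_lt {x y z r : Fin l} (h : x ≤ y) (h' : y ≤ z) :
    (x ≤ r ∧ r < z) ↔ (x ≤ r ∧ r < y) ∨ (y ≤ r ∧ r < z) := by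
  simp only [Fin.le_def, Fin.lt_def] at *; omega

theorem cut_lt_le {x y z r : Fin l} (h : x ≤ y) (h' : y ≤ z) :
    (x < r ∧ r ≤ z) ↔ (x < r ∧ r ≤ y) ∨ (y < r ∧ r ≤ z) := by
  simp only [Fin.le_def, Fin.lt_def] at *; omega

theorem not_le_lt (x y z r : Fin l) : ¬ ((x ≤ r ∧ r < y) ∧ (y ≤ r ∧ r < z)) :=
  fun h => absurd h.2.1 (not_le.2 h.1.2)

theorem not_lt_le (x y z r : Fin l) : ¬ ((x < r ∧ r ≤ y) ∧ (y < r ∧ r ≤ z)) :=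
  fun h => absurd h.2.1 (not_lt.2 h.1.2)

theorem quad_identity (T : Box q → Box q → Box q → Box q → M)
    (hT : ∀ c d i j, ¬ (d.1 ≤ c.1 ∧ j.1 < i.1) → T c d i j = 0)
    (a b i j : Box q) (hab : b.1 ≤ a.1) (hij : j.1 ≤ i.1)
    (Qd : Box q → Box q → Box q → Box q → M)
    (hQd : ∀ a b i j, Qd a b i j =
      (∑ r : Box q, if j.1 ≤ r.1 ∧ r.1 < i.1 then
        ((if b = r then T a j i r else 0) - (if a = j then T r b i r else 0)
          + (if b = i then T r j a r else 0) - (if a = r then T r j i b else 0)) else 0)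
      - ∑ r : Box q, if j.1 < r.1 ∧ r.1 ≤ i.1 then
        ((if b = i then T a r r j else 0) - (if a = r then T i b r j else 0)
          + (if b = r then T i r a j else 0) - (if a = j then T i r r b else 0)) else 0)
    (S : Box q → Box q → M)
    (hS : ∀ i j, S i j = (∑ r : Box q, if j.1 ≤ r.1 ∧ r.1 < i.1 then T r j i r else 0)
      - ∑ r : Box q, if j.1 < r.1 ∧ r.1 ≤ i.1 then T i r r j else 0) :
    Qd a b i j - Qd i j a b = (if b = i then S a j else 0) - (if a = j then S i b else 0) := by
  have key : ∀ a b i j : Box q, Qd a b i j =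
      ((if j.1 ≤ b.1 ∧ b.1 < i.1 then T a j i b else 0)
        - (if j.1 ≤ a.1 ∧ a.1 < i.1 then T a j i b else 0)
        - (if j.1 < b.1 ∧ b.1 ≤ i.1 then T i b a j else 0)
        + (if j.1 < a.1 ∧ a.1 ≤ i.1 then T i b a j else 0))
      + (if b = i then ((∑ r : Box q, if j.1 ≤ r.1 ∧ r.1 < i.1 then T r j a r else 0)
          - ∑ r : Box q, if j.1 < r.1 ∧ r.1 ≤ i.1 then T a r r j else 0) else 0)
      - (if a = j then ((∑ r : Box q, if j.1 ≤ r.1 ∧ r.1 < i.1 then T r b i r else 0)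
          - ∑ r : Box q, if j.1 < r.1 ∧ r.1 ≤ i.1 then T i r r b else 0) else 0) := by
    intro a b i j
    have e1 : ∀ (b : Box q) (p : Box q → Prop) [DecidablePred p] (f : Box q → M),
        (if p b then f b else 0) = ∑ r, if p r then (if b = r then f r else 0) else 0 := by
      intro b p _ f
      rw [Finset.sum_eq_single b]
      · simp
      · intro r _ hr; simp [hr.symm]
      · simp
    rw [hQd, e1 b (fun r => j.1 ≤ r.1 ∧ r.1 < i.1) (fun r => T a j i r),
      e1 a (fun r => j.1 ≤ r.1 ∧ r.1 < i.1) (fun r => T r j i b),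
      e1 b (fun r => j.1 < r.1 ∧ r.1 ≤ i.1) (fun r => T i r a j),
      e1 a (fun r => j.1 < r.1 ∧ r.1 ≤ i.1) (fun r => T i b r j)]
    have e2 : ∀ (P : Prop) [Decidable P] (f g : Box q → M),
        (if P then (∑ r, f r) - ∑ r, g r else 0)
          = (∑ r, if P then f r else 0) - ∑ r, if P then g r else 0 := by
      intro P _ f g; split_ifs <;> simp
    rw [e2, e2]
    simp only [← Finset.sum_sub_distrib, ← Finset.sum_add_distrib]
    refine Finset.sum_congr rfl fun r _ => ?_
    by_cases c1 : j.1 ≤ r.1 ∧ r.1 < i.1 <;> by_cases c2 : j.1 < r.1 ∧ r.1 ≤ i.1 <;>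
      simp only [c1, c2, if_true, if_false, ite_self, and_self] <;> abel
  have d1 : ((if j.1 ≤ b.1 ∧ b.1 < i.1 then T a j i b else 0)
        - (if j.1 ≤ a.1 ∧ a.1 < i.1 then T a j i b else 0)
        - (if b.1 < i.1 ∧ i.1 ≤ a.1 then T a j i b else 0)
        + (if b.1 < j.1 ∧ j.1 ≤ a.1 then T a j i b else 0)) = 0 := by
    by_cases h : j.1 ≤ a.1 ∧ b.1 < i.1
    · obtain ⟨h1, h2⟩ := h
      rcases le_or_gt j.1 b.1 with c1 | c1 <;> rcases lt_or_ge a.1 i.1 with c2 | c2 <;>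
        simp [h1, h2, c1, c2, not_le.2, not_lt.2]
    · rw [hT _ _ _ _ h]; simp
  have d2 : (-(if j.1 < b.1 ∧ b.1 ≤ i.1 then T i b a j else 0)
        + (if j.1 < a.1 ∧ a.1 ≤ i.1 then T i b a j else 0)
        - (if b.1 ≤ j.1 ∧ j.1 < a.1 then T i b a j else 0)
        + (if b.1 ≤ i.1 ∧ i.1 < a.1 then T i b a j else 0)) = 0 := by
    by_cases h : b.1 ≤ i.1 ∧ j.1 < a.1
    · obtain ⟨h1, h2⟩ := h
      rcases le_or_gt b.1 j.1 with c1 | c1 <;> rcases le_or_gt a.1 i.1 with c2 | c2 <;>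
        simp [h1, h2, c1, c2, not_le.2, not_lt.2]
    · rw [hT _ _ _ _ h]; simp
  have d3 : b = i → ((∑ r : Box q, if j.1 ≤ r.1 ∧ r.1 < i.1 then T r j a r else 0)
          - ∑ r : Box q, if j.1 < r.1 ∧ r.1 ≤ i.1 then T a r r j else 0) +
       ((∑ r : Box q, if b.1 ≤ r.1 ∧ r.1 < a.1 then T r j a r else 0)
          - ∑ r : Box q, if b.1 < r.1 ∧ r.1 ≤ a.1 then T a r r j else 0) = S a j := by
    rintro rfl
    rw [hS]
    simp only [← Finset.sum_sub_distrib, ← Finset.sum_add_distrib]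
    refine Finset.sum_congr rfl fun r _ => ?_
    rw [← ite_add_ite (T r j a r) (p₁ := j.1 ≤ r.1 ∧ r.1 < b.1) (p₂ := b.1 ≤ r.1 ∧ r.1 < a.1)
        (cut_le_lt hij hab) (not_le_lt _ _ _ _),
      ← ite_add_ite (T a r r j) (p₁ := j.1 < r.1 ∧ r.1 ≤ b.1) (p₂ := b.1 < r.1 ∧ r.1 ≤ a.1)
        (cut_lt_le hij hab) (not_lt_le _ _ _ _)]
    abel
  have d4 : a = j → ((∑ r : Box q, if j.1 ≤ r.1 ∧ r.1 < i.1 then T r b i r else 0)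
          - ∑ r : Box q, if j.1 < r.1 ∧ r.1 ≤ i.1 then T i r r b else 0) +
       ((∑ r : Box q, if b.1 ≤ r.1 ∧ r.1 < a.1 then T r b i r else 0)
          - ∑ r : Box q, if b.1 < r.1 ∧ r.1 ≤ a.1 then T i r r b else 0) = S i b := by
    rintro rfl
    rw [hS]
    simp only [← Finset.sum_sub_distrib, ← Finset.sum_add_distrib]
    refine Finset.sum_congr rfl fun r _ => ?_
    rw [← ite_add_ite (T r b i r) (p₁ := a.1 ≤ r.1 ∧ r.1 < i.1) (p₂ := b.1 ≤ r.1 ∧ r.1 < a.1)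
        ((cut_le_lt hab hij).trans or_comm) (fun h => not_le_lt _ _ _ _ h.symm),
      ← ite_add_ite (T i r r b) (p₁ := a.1 < r.1 ∧ r.1 ≤ i.1) (p₂ := b.1 < r.1 ∧ r.1 ≤ a.1)
        ((cut_lt_le hab hij).trans or_comm) (fun h => not_lt_le _ _ _ _ h.symm)]
    abel
  rw [key a b i j, key i j a b]
  have f3 : (if b = i then S a j else 0) = (if b = i then
      ((∑ r : Box q, if j.1 ≤ r.1 ∧ r.1 < i.1 then T r j a r else 0)
          - ∑ r : Box q, if j.1 < r.1 ∧ r.1 ≤ i.1 then T a r r j else 0) else 0) +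
      (if i = b then ((∑ r : Box q, if b.1 ≤ r.1 ∧ r.1 < a.1 then T r j a r else 0)
          - ∑ r : Box q, if b.1 < r.1 ∧ r.1 ≤ a.1 then T a r r j else 0) else 0) := by
    by_cases h : b = i
    · rw [if_pos h, if_pos h, if_pos h.symm, d3 h]
    · rw [if_neg h, if_neg h, if_neg (Ne.symm h), add_zero]
  have f4 : (if a = j then S i b else 0) = (if a = j then
      ((∑ r : Box q, if j.1 ≤ r.1 ∧ r.1 < i.1 then T r b i r else 0)
          - ∑ r : Box q, if j.1 < r.1 ∧ r.1 ≤ i.1 then T i r r b else 0) else 0) +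
      (if j = a then ((∑ r : Box q, if b.1 ≤ r.1 ∧ r.1 < a.1 then T r b i r else 0)
          - ∑ r : Box q, if b.1 < r.1 ∧ r.1 ≤ a.1 then T i r r b else 0) else 0) := by
    by_cases h : a = j
    · rw [if_pos h, if_pos h, if_pos h.symm, d4 h]
    · rw [if_neg h, if_neg h, if_neg (Ne.symm h), add_zero]
  rw [f3, f4, ← sub_eq_zero]
  clear f3 f4 d3 d4 key hS hQd hT
  trans ((if j.1 ≤ b.1 ∧ b.1 < i.1 then T a j i b else 0)
        - (if j.1 ≤ a.1 ∧ a.1 < i.1 then T a j i b else 0)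
        - (if b.1 < i.1 ∧ i.1 ≤ a.1 then T a j i b else 0)
        + (if b.1 < j.1 ∧ j.1 ≤ a.1 then T a j i b else 0)) +
      (-(if j.1 < b.1 ∧ b.1 ≤ i.1 then T i b a j else 0)
        + (if j.1 < a.1 ∧ a.1 ≤ i.1 then T i b a j else 0)
        - (if b.1 ≤ j.1 ∧ j.1 < a.1 then T i b a j else 0)
        + (if b.1 ≤ i.1 ∧ i.1 < a.1 then T i b a j else 0))
  swap
  · rw [d1, d2, add_zero]
  clear d1 d2
  have fin : ∀ x1 x2 x3 x4 y1 y2 y3 y4 s1 s2 s3 s4 : M,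
      ((x1 - x2 - y1 + y2) + s1 - s2) - ((y3 - y4 - x4 + x3) + s3 - s4) - ((s1 + s4) - (s2 + s3)) = 
       (x1 - x2 - x3 + x4) + (- y1 + y2 - y3 + y4) := by
    intros; abel
  exact fin _ _ _ _ _ _ _ _ _ _ _ _
end Key

section Counting
variable {l : ℕ} {q : Fin l → ℕ}

/-- Auxiliary: the number of boxes in the columns `x+1, …, y`. -/
def cnt (q : Fin l → ℕ) (x y : Fin l) : ℕ :=
  (Finset.univ.filter fun r : Box q => x < r.1 ∧ r.1 ≤ y).card

theorem cnt_add {x y z : Fin l} (h : x ≤ y) (h' : y ≤ z) : cnt q x z = cnt q x y + cnt q y z := by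
  unfold cnt
  rw [← Finset.card_union_of_disjoint]
  · congr 1; ext r
    simp only [Finset.mem_filter, Finset.mem_univ, true_and, Finset.mem_union]
    exact cut_lt_le h h'
  · rw [Finset.disjoint_left]
    intro r h1 h2
    simp only [Finset.mem_filter, Finset.mem_univ, true_and] at h1 h2
    exact not_lt_le _ _ _ _ ⟨h1, h2⟩

theorem card_col (y : Fin l) : (Finset.univ.filter fun r : Box q => r.1 = y).card = q y := by
  have : (Finset.univ.filter fun r : Box q => r.1 = y)
      = Finset.univ.image (fun t : Fin (q y) => (⟨y, t⟩ : Box q)) := by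
    ext ⟨a, t⟩
    simp only [Finset.mem_filter, Finset.mem_univ, true_and, Finset.mem_image]
    constructor
    · rintro rfl; exact ⟨t, rfl⟩
    · rintro ⟨t', h⟩; exact (congrArg Sigma.fst h).symm
  rw [this, Finset.card_image_of_injective, Finset.card_univ, Fintype.card_fin]
  intro a b h
  simpa using h

theorem cnt_shift {x y : Fin l} (h : x ≤ y) :
    (Finset.univ.filter fun r : Box q => x ≤ r.1 ∧ r.1 < y).card + q y = cnt q x y + q x := by
  unfold cnt
  conv_lhs => rw [← card_col (q := q) y]
  conv_rhs => rw [← card_col (q := q) x]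
  rw [← Finset.card_union_of_disjoint, ← Finset.card_union_of_disjoint]
  · congr 1; ext r
    simp only [Finset.mem_filter, Finset.mem_univ, true_and, Finset.mem_union, Fin.le_def,
      Fin.lt_def, Fin.ext_iff] at *
    omega
  · rw [Finset.disjoint_left]
    intro r h1 h2
    simp only [Finset.mem_filter, Finset.mem_univ, true_and, Fin.lt_def, Fin.ext_iff] at h1 h2
    omega
  · rw [Finset.disjoint_left]
    intro r h1 h2
    simp only [Finset.mem_filter, Finset.mem_univ, true_and, Fin.lt_def, Fin.ext_iff] at h1 h2
    omega

variable {M : Type*} [AddCommGroup M] [Module ℂ M]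

theorem first_order (α : Fin l → ℂ) (hα : ∀ s t, α s + q s = α t + q t)
    (p : Box q → Box q → M) (hp : ∀ i j, ¬ j.1 < i.1 → p i j = 0)
    (a b i j : Box q) (hab : b.1 ≤ a.1) (hij : j.1 ≤ i.1)
    (C : Box q → Box q → ℂ) 
    (hC : ∀ i j, C i j = if j.1 < i.1 then α i.1 + cnt q j.1 i.1 else 0) :
    (∑ r : Box q, if j.1 ≤ r.1 ∧ r.1 < i.1 then
        ((if b = r then (if j = i then p a r else 0) - (if a = r then p i j else 0) else 0)
        - (if a = j then (if b = i then p r r else 0) - (if r = r then p i b else 0) else 0)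
        + formB α a b r j • p i r) else 0)
    - (∑ r : Box q, if j.1 < r.1 ∧ r.1 ≤ i.1 then
        ((if b = i then (if r = r then p a j else 0) - (if a = j then p r r else 0) else 0)
        - (if a = r then (if b = r then p i j else 0) - (if i = j then p r b else 0) else 0)
        + formB α a b i r • p r j) else 0)
    = (if b = i then (C a b - C a j) • p a j else 0)
      + (if a = j then (C i b - C a b) • p i b else 0) := by
  by_cases hlt : j.1 < i.1
  swap
  · have hji : j.1 = i.1 := le_antisymm hij (not_lt.1 hlt)
    rw [Finset.sum_eq_zero, Finset.sum_eq_zero]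
    · have h1 : (if b = i then (C a b - C a j) • p a j else 0) = 0 := by
        split_ifs with h
        · subst h; simp [hC, hji]
        · rfl
      have h2 : (if a = j then (C i b - C a b) • p i b else 0) = 0 := by
        split_ifs with h
        · subst h
          rcases eq_or_ne (b.1) (i.1) with h3 | h3
          · rw [hp _ _ (by rw [h3]; exact lt_irrefl _), smul_zero]
          · simp [hC, hji]
        · rfl
      rw [h1, h2]; simp
    · intro r _; rw [if_neg]; intro h; exact hlt (h.1.trans_le h.2)
    · intro r _; rw [if_neg]; intro h; exact hlt (h.1.trans_lt h.2)
  have hne : j ≠ i := fun h => hlt.ne (congrArg Sigma.fst h)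
  have prr : ∀ r, p r r = 0 := fun r => hp _ _ (lt_irrefl _)
  have e1 : ∀ r : Box q, (if j.1 ≤ r.1 ∧ r.1 < i.1 then
        ((if b = r then (if j = i then p a r else 0) - (if a = r then p i j else 0) else 0)
        - (if a = j then (if b = i then p r r else 0) - (if r = r then p i b else 0) else 0)
        + formB α a b r j • p i r) else 0) =
      (if r = a then (if a = b then (if j.1 ≤ a.1 ∧ a.1 < i.1 then - p i j else 0) else 0) else 0)
      + (if j.1 ≤ r.1 ∧ r.1 < i.1 then (if a = j then p i b else 0) else 0)
      + (if r = b then (if a = j ∧ j.1 ≤ b.1 ∧ b.1 < i.1 then α a.1 • p i b else 0) else 0)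
      + (if r = j then (if a = b ∧ a.1 = j.1 then p i j else 0) else 0) := by
    intro r
    by_cases c : j.1 ≤ r.1 ∧ r.1 < i.1
    · rw [if_pos c]
      have s1 : (if b = r then (if j = i then p a r else 0) - (if a = r then p i j else 0) else 0)
          = (if r = a then (if a = b then (if j.1 ≤ a.1 ∧ a.1 < i.1 then - p i j else 0) else 0)
            else 0) := by
        rw [if_neg hne]
        by_cases h1 : b = r <;> by_cases h2 : a = r
        · subst h1; subst h2; simp [c]
        · simp [h1, h2, Ne.symm h2]
        · subst h2; simp [h1, Ne.symm h1]
        · simp [h1, Ne.symm h2]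
      have s2 : formB α a b r j • p i r =
          (if r = b then (if a = j ∧ j.1 ≤ b.1 ∧ b.1 < i.1 then α a.1 • p i b else 0) else 0)
          + (if r = j then (if a = b ∧ a.1 = j.1 then p i j else 0) else 0) := by
        unfold formB
        rw [add_smul]
        congr 1
        · by_cases h1 : b = r
          · subst h1; simp [c]
          · simp [h1, Ne.symm h1]
        · by_cases h1 : r = j
          · subst h1; simp
          · simp [h1]
      rw [s1, s2, if_pos c, prr]
      simp only [ite_self, if_true, zero_sub]
      split_ifs <;> abel
    · rw [if_neg c, if_neg c]
      have s1 : (if r = a then (if a = b then (if j.1 ≤ a.1 ∧ a.1 < i.1 then - p i j else 0) else 0)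
            else 0) = 0 := by
        split_ifs with h1 h2 h3
        · subst h1; exact absurd h3 c
        all_goals rfl
      have s2 : (if r = b then (if a = j ∧ j.1 ≤ b.1 ∧ b.1 < i.1 then α a.1 • p i b else 0) else 0)
          = 0 := by
        split_ifs with h1 h2
        · subst h1; exact absurd h2.2 c
        all_goals rfl
      have s3 : (if r = j then (if a = b ∧ a.1 = j.1 then p i j else 0) else 0) = 0 := by
        split_ifs with h1 h2
        · subst h1; exact absurd ⟨le_rfl, hlt⟩ c
        all_goals rfl
      rw [s1, s2, s3]; simp
  have e2 : ∀ r : Box q, (if j.1 < r.1 ∧ r.1 ≤ i.1 then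
        ((if b = i then (if r = r then p a j else 0) - (if a = j then p r r else 0) else 0)
        - (if a = r then (if b = r then p i j else 0) - (if i = j then p r b else 0) else 0)
        + formB α a b i r • p r j) else 0) =
      (if r = a then (if a = b then (if j.1 < a.1 ∧ a.1 ≤ i.1 then - p i j else 0) else 0) else 0)
      + (if j.1 < r.1 ∧ r.1 ≤ i.1 then (if b = i then p a j else 0) else 0)
      + (if r = a then (if b = i ∧ j.1 < a.1 ∧ a.1 ≤ i.1 then α a.1 • p a j else 0) else 0)
      + (if r = i then (if a = b ∧ a.1 = i.1 then p i j else 0) else 0) := by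
    intro r
    by_cases c : j.1 < r.1 ∧ r.1 ≤ i.1
    · rw [if_pos c]
      have s1 : (if a = r then (if b = r then p i j else 0) - (if i = j then p r b else 0) else 0)
          = - (if r = a then (if a = b then (if j.1 < a.1 ∧ a.1 ≤ i.1 then - p i j else 0) else 0)
            else 0) := by
        rw [if_neg hne.symm]
        by_cases h1 : b = r <;> by_cases h2 : a = r
        · subst h1; subst h2; simp [c]
        · simp [h2, Ne.symm h2]
        · subst h2; simp [h1, Ne.symm h1]
        · simp [h2, Ne.symm h2]
      have s2 : formB α a b i r • p r j =
          (if r = a then (if b = i ∧ j.1 < a.1 ∧ a.1 ≤ i.1 then α a.1 • p a j else 0) else 0)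
          + (if r = i then (if a = b ∧ a.1 = i.1 then p i j else 0) else 0) := by
        unfold formB
        rw [add_smul]
        congr 1
        · by_cases h1 : a = r
          · subst h1; simp [c]
          · simp [h1, Ne.symm h1]
        · by_cases h1 : i = r
          · subst h1; simp
          · simp [h1, Ne.symm h1]
      rw [s1, s2, if_pos c, prr]
      simp only [ite_self, if_true, sub_zero]
      abel
    · rw [if_neg c, if_neg c]
      have s1 : (if r = a then (if a = b then (if j.1 < a.1 ∧ a.1 ≤ i.1 then - p i j else 0) else 0)
            else 0) = 0 := by
        split_ifs with h1 h2 h3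
        · subst h1; exact absurd h3 c
        all_goals rfl
      have s2 : (if r = a then (if b = i ∧ j.1 < a.1 ∧ a.1 ≤ i.1 then α a.1 • p a j else 0) else 0)
          = 0 := by
        split_ifs with h1 h2
        · subst h1; exact absurd h2.2 c
        all_goals rfl
      have s3 : (if r = i then (if a = b ∧ a.1 = i.1 then p i j else 0) else 0) = 0 := by
        split_ifs with h1 h2
        · subst h1; exact absurd ⟨hlt, le_rfl⟩ c
        all_goals rfl
      rw [s1, s2, s3]; simp
  rw [Finset.sum_congr rfl fun r _ => e1 r, Finset.sum_congr rfl fun r _ => e2 r]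
  simp only [Finset.sum_add_distrib, Finset.sum_ite_eq', Finset.mem_univ, if_true]
  have hsum : ∀ (Z : Box q → Prop) [DecidablePred Z] (z : M),
      (∑ r : Box q, if Z r then z else 0) = (Finset.univ.filter Z).card • z := by
    intro Z _ z
    rw [← Finset.sum_filter, Finset.sum_const]
  rw [hsum, hsum]
  have hsh := cnt_shift (q := q) hij
  set c' := (Finset.univ.filter fun r : Box q => j.1 ≤ r.1 ∧ r.1 < i.1).card
  change _ - (_ + cnt q j.1 i.1 • _ + _ + _) = _
  have P0 : ((if a = b then (if j.1 ≤ a.1 ∧ a.1 < i.1 then - p i j else 0) else 0)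
      + (if a = b ∧ a.1 = j.1 then p i j else 0))
      - ((if a = b then (if j.1 < a.1 ∧ a.1 ≤ i.1 then - p i j else 0) else 0)
      + (if a = b ∧ a.1 = i.1 then p i j else 0)) = 0 := by
    by_cases h : a = b
    · simp only [h, if_true, true_and]
      rcases lt_trichotomy b.1 j.1 with h1 | h1 | h1
      · simp [h1.ne, (h1.trans hlt).ne, not_le.2 h1, h1.not_gt]
      · simp [h1, hlt, hlt.ne]
      · rcases lt_trichotomy b.1 i.1 with h2 | h2 | h2
        · simp [h1, h2, h1.le, h2.le, h1.ne', h2.ne]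
        · simp [h2, hlt, hlt.le, hlt.ne']
        · simp [h1.ne', h2.ne', not_le.2 h2, h2.not_gt]
    · simp [h]
  have P1 : (c' • (if a = j then p i b else 0)
      + (if a = j ∧ j.1 ≤ b.1 ∧ b.1 < i.1 then α a.1 • p i b else 0))
      = (if a = j then (C i b - C a b) • p i b else 0) := by
    by_cases h : a = j
    · subst h
      simp only [if_true, true_and]
      have hbi := hab.trans_lt hlt
      have hq := hα a.1 i.1
      have hsh' : (c' : ℂ) + q i.1 = cnt q a.1 i.1 + q a.1 := by exact_mod_cast hsh
      have hadd : (cnt q b.1 i.1 : ℂ) = cnt q b.1 a.1 + cnt q a.1 i.1 := by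
        exact_mod_cast cnt_add (q := q) hab hij
      rw [hC, hC, if_pos hbi, ← Nat.cast_smul_eq_nsmul ℂ]
      rcases hab.lt_or_eq with h1 | h1
      · rw [if_neg (by simp [not_le.2 h1]), if_pos h1, add_zero]
        congr 1
        linear_combination hsh' - hadd + hq
      · rw [if_pos ⟨h1.ge, hbi⟩, if_neg (by simp [h1]), ← add_smul]
        congr 1
        rw [h1]
        linear_combination hsh' + hq
    · simp [h]
  have P2 : (cnt q j.1 i.1 • (if b = i then p a j else 0)
      + (if b = i ∧ j.1 < a.1 ∧ a.1 ≤ i.1 then α a.1 • p a j else 0))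
      = - (if b = i then (C a b - C a j) • p a j else 0) := by
    by_cases h : b = i
    · subst h
      simp only [if_true, true_and]
      have hja := hlt.trans_le hab
      have hadd : (cnt q j.1 a.1 : ℂ) = cnt q j.1 b.1 + cnt q b.1 a.1 := by
        exact_mod_cast cnt_add (q := q) hij hab
      rw [hC, hC, if_pos hja, ← Nat.cast_smul_eq_nsmul ℂ, ← neg_smul]
      rcases hab.lt_or_eq with h1 | h1
      · rw [if_neg (by simp [not_le.2 h1]), if_pos h1, add_zero]
        congr 1
        linear_combination - hadd
      · rw [if_pos ⟨hja, h1.ge⟩, if_neg (by simp [h1]), ← add_smul]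
        congr 1
        rw [h1]
        ring
    · simp [h]
  rw [eq_neg_iff_add_eq_zero] at P2
  rw [← P1]
  generalize (if b = i then (C a b - C a j) • p a j else 0) = z at *
  have fin : ∀ x1 u x3 x4 y1 w y3 y4 : M, (x1 + x4) - (y1 + y4) = 0 → w + y3 + z = 0 →
      (x1 + u + x3 + x4) - (y1 + w + y3 + y4) = z + (u + x3) := by
    intro x1 u x3 x4 y1 w y3 y4 h1 h2
    obtain rfl : z = -(w + y3) := (neg_eq_of_add_eq_zero_right h2).symm
    obtain rfl : x1 = y1 + y4 - x4 := eq_sub_of_add_eq (sub_eq_zero.1 h1)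
    abel
  exact fin _ _ _ _ _ _ _ _ P0 P2

end Counting

section Differential
variable {l : ℕ} {q : Fin l → ℕ} {A M : Type*} [Ring A] [Algebra ℂ A] [AddCommGroup M]
  [Module A M] [Module ℂ M] [IsScalarTower ℂ A M]

theorem lin_identity (p : Box q → Box q → M) (a b i j : Box q)
    (LC : Box q → Box q → Box q → Box q → M)
    (hLC : ∀ a b i j, LC a b i j = (∑ h : Box q, if RightOf h i then
        ((if b = h then p a j else 0) - (if a = j then p h b else 0)) else 0)
      - ∑ h : Box q, if RightOf j h then
        ((if b = i then p a h else 0) - (if a = h then p i b else 0)) else 0)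
    (L : Box q → Box q → M)
    (hL : ∀ i j, L i j = (∑ h : Box q, if RightOf h i then p h j else 0)
      - ∑ h : Box q, if RightOf j h then p i h else 0) :
    LC a b i j - LC i j a b = (if b = i then L a j else 0) - (if a = j then L i b else 0) := by
  have key : ∀ a b i j : Box q, LC a b i j = ((if RightOf b i then p a j else 0)
      - (if a = j then (∑ h : Box q, if RightOf h i then p h b else 0) else 0))
      - ((if b = i then (∑ h : Box q, if RightOf j h then p a h else 0) else 0)
        - (if RightOf j a then p i b else 0)) := by
    intro a b i j
    have e1 : ∀ (b : Box q) (Z : Box q → Prop) [DecidablePred Z] (f : M),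
        (if Z b then f else 0) = ∑ r, if Z r then (if b = r then f else 0) else 0 := by
      intro b Z _ f
      rw [Finset.sum_eq_single b]
      · simp
      · intro r _ hr; simp [hr.symm]
      · simp
    have e2 : ∀ (Z : Prop) [Decidable Z] (f : Box q → M),
        (if Z then (∑ r, f r) else 0) = (∑ r, if Z then f r else 0) := by
      intro Z _ f; split_ifs <;> simp
    rw [hLC, e1 b (fun r => RightOf r i), e1 a (fun r => RightOf j r), e2, e2]
    simp only [← Finset.sum_sub_distrib]
    refine Finset.sum_congr rfl fun r _ => ?_
    by_cases c1 : RightOf r i <;> by_cases c2 : RightOf j r <;>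
      simp only [c1, c2, if_true, if_false, ite_self, sub_zero]
  rw [key, key, hL, hL]
  by_cases h1 : b = i <;> by_cases h2 : a = j
  · subst h1; subst h2; simp only [if_true]; abel
  · subst h1; simp only [if_true, h2, Ne.symm h2, if_false]; abel
  · subst h2; simp only [if_true, h1, Ne.symm h1, if_false]; abel
  · simp only [h1, h2, Ne.symm h1, Ne.symm h2, if_false]; abel

variable (E P : Box q → Box q → ℤ → A) (α : Fin l → ℂ)

/-- Auxiliary: the commutation relations of the modes of `𝔞`, proved for them in `currentRel`. -/
structure CurrentRel (M : Type*) [AddCommGroup M] [Module A M] : Prop where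
  e_field : ∀ i j, Truncated M (E i j)
  p_field : ∀ i j, Truncated M (P i j)
  p_zero : ∀ i j : Box q, ¬ j.1 < i.1 → P i j = 0
  e_zero : ∀ i j : Box q, ¬ j.1 ≤ i.1 → E i j = 0
  e_e : ∀ a b i j : Box q, b.1 ≤ a.1 → j.1 ≤ i.1 → ∀ m n : ℤ,
    E a b m * E i j n - E i j n * E a b m =
      (if b = i then E a j (m + n) else 0) - (if a = j then E i b (m + n) else 0)
      + algebraMap ℂ A (if m + n = 0 then m * formB α a b i j else 0)
  e_p : ∀ a b i j : Box q, b.1 ≤ a.1 → j.1 < i.1 → ∀ m n : ℤ,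
    E a b m * P i j n - P i j n * E a b m =
      (if b = i then P a j (m + n) else 0) - (if a = j then P i b (m + n) else 0)

variable {E P α}

theorem Truncated.ite {x : ℤ → A} (c : Prop) [Decidable c] (hx : Truncated M x) :
    Truncated M (if c then x else 0) := by
  split_ifs
  · exact hx
  · exact Truncated.zero

theorem normal_comm (H : CurrentRel E P α M) (a b c d i j : Box q) (hab : b.1 ≤ a.1)
    (hcd : d.1 ≤ c.1) (hij : j.1 < i.1) (m n : ℤ) (v : M) :
    E a b m • cutMode (E c d) (P i j) 0 n v - cutMode (E c d) (P i j) 0 n (E a b m • v) =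
      ((if b = c then cutMode (E a d) (P i j) 0 (m + n) v else 0)
        - (if a = d then cutMode (E c b) (P i j) 0 (m + n) v else 0)
        + (if b = i then cutMode (E c d) (P a j) 0 (m + n) v else 0)
        - (if a = j then cutMode (E c d) (P i b) 0 (m + n) v else 0))
      + (m : ℂ) • (((if b = c then (if d = i then P a j (m + n - 1) • v else 0)
              - (if a = j then P i d (m + n - 1) • v else 0) else 0)
          - (if a = d then (if b = i then P c j (m + n - 1) • v else 0)
              - (if c = j then P i b (m + n - 1) • v else 0) else 0))
        + formB α a b c d • P i j (m + n - 1) • v) := by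
  have fx' : Truncated M ((if b = c then E a d else 0) - (if a = d then E c b else 0)) :=
    (Truncated.ite _ (H.e_field _ _)).sub (Truncated.ite _ (H.e_field _ _))
  have fy' : Truncated M ((if b = i then P a j else 0) - (if a = j then P i b else 0)) :=
    (Truncated.ite _ (H.p_field _ _)).sub (Truncated.ite _ (H.p_field _ _))
  have z1 : ∀ s, E a b m * E c d s - E c d s * E a b m
      = ((if b = c then E a d else 0) - (if a = d then E c b else 0)) (m + s)
        + if m + s = 0 then algebraMap ℂ A (m * formB α a b c d) else 0 := by
    intro s
    rw [H.e_e a b c d hab hcd]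
    congr 1
    · simp only [Pi.sub_apply]
      split_ifs <;> rfl
    · split_ifs <;> simp
  have z2 : ∀ s, E a b m * P i j s - P i j s * E a b m
      = ((if b = i then P a j else 0) - (if a = j then P i b else 0)) (m + s) := by
    intro s
    rw [H.e_p a b i j hab hij]
    simp only [Pi.sub_apply]
    split_ifs <;> rfl
  rw [cutMode_comm (H.e_field c d) (H.p_field i j) fx' fy' z1 z2
    (fun s => Algebra.commutes _ _)]
  have hw : ∀ s t, ((if b = c then E a d else 0) - (if a = d then E c b else 0)) s * P i j t
      - P i j t * ((if b = c then E a d else 0) - (if a = d then E c b else 0)) s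
      = ((if b = c then (if d = i then P a j else 0) - (if a = j then P i d else 0) else 0)
        - (if a = d then (if b = i then P c j else 0) - (if c = j then P i b else 0) else 0))
          (s + t) := by
    intro s t
    have h1 : (if b = c then E a d else 0) s * P i j t - P i j t * (if b = c then E a d else 0) s
        = (if b = c then (if d = i then P a j else 0) - (if a = j then P i d else 0) else 0)
          (s + t) := by
      by_cases h : b = c
      · subst h
        simp only [if_true]
        rw [H.e_p a d i j (hcd.trans hab) hij]
        simp only [Pi.sub_apply]
        split_ifs <;> rfl
      · simp [h]
    have h2 : (if a = d then E c b else 0) s * P i j t - P i j t * (if a = d then E c b else 0) s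
        = (if a = d then (if b = i then P c j else 0) - (if c = j then P i b else 0) else 0)
          (s + t) := by
      by_cases h : a = d
      · subst h
        simp only [if_true]
        rw [H.e_p c b i j (hab.trans hcd) hij]
        simp only [Pi.sub_apply]
        split_ifs <;> rfl
      · simp [h]
    rw [Pi.sub_apply, Pi.sub_apply, ← h1, ← h2, sub_mul, mul_sub]
    abel
  rw [cutMode_eq fx' (H.p_field i j) hw]
  have ex : cutMode ((if b = c then E a d else 0) - (if a = d then E c b else 0)) (P i j) 0 (m + n) v
      = (if b = c then cutMode (E a d) (P i j) 0 (m + n) v else 0)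
        - (if a = d then cutMode (E c b) (P i j) 0 (m + n) v else 0) := by
    rw [sub_eq_add_neg, cutMode_add_left (Truncated.ite _ (H.e_field _ _))
      (Truncated.ite _ (H.e_field _ _)).neg (H.p_field _ _), cutMode_neg_left, ← sub_eq_add_neg]
    congr 1 <;> split_ifs <;> simp [cutMode_zero_left]
  have ey : cutMode (E c d) ((if b = i then P a j else 0) - (if a = j then P i b else 0)) 0 (m + n) v
      = (if b = i then cutMode (E c d) (P a j) 0 (m + n) v else 0)
        - (if a = j then cutMode (E c d) (P i b) 0 (m + n) v else 0) := by
    rw [sub_eq_add_neg, cutMode_add_right (H.e_field _ _) (Truncated.ite _ (H.p_field _ _))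
      (Truncated.ite _ (H.p_field _ _)).neg, cutMode_neg_right, ← sub_eq_add_neg]
    congr 1 <;> split_ifs <;> simp [cutMode_zero_right]
  rw [ex, ey, smul_add, ← Int.cast_smul_eq_zsmul ℂ, algebraMap_smul, mul_smul]
  have ew : ((if b = c then (if d = i then P a j else 0) - (if a = j then P i d else 0) else 0)
        - (if a = d then (if b = i then P c j else 0) - (if c = j then P i b else 0) else 0))
          (m + n - 1) • v =
      (if b = c then (if d = i then P a j (m + n - 1) • v else 0)
              - (if a = j then P i d (m + n - 1) • v else 0) else 0)
          - (if a = d then (if b = i then P c j (m + n - 1) • v else 0)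
              - (if c = j then P i b (m + n - 1) • v else 0) else 0) := by
    rw [Pi.sub_apply, sub_smul]
    congr 1 <;> split_ifs <;> simp [sub_smul]
  rw [ew]
  abel

/-- Auxiliary: the coefficient of `ψ_{i,j}[-2]` when all products are written as `e ψ`. -/
def coefC (q : Fin l → ℕ) (α : Fin l → ℂ) (i j : Box q) : ℂ :=
  if j.1 < i.1 then α i.1 + cnt q j.1 i.1 else 0

theorem diffMode_eq (H : CurrentRel E P α M) (i j : Box q) (n : ℤ) (v : M) :
    diffMode E P α i j n v =
      (((∑ r : Box q, if j.1 ≤ r.1 ∧ r.1 < i.1 then cutMode (E r j) (P i r) 0 n v else 0)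
      - ∑ r : Box q, if j.1 < r.1 ∧ r.1 ≤ i.1 then cutMode (E i r) (P r j) 0 n v else 0)
      - (n : ℂ) • coefC q α i j • P i j (n - 1) • v)
      + ((∑ h : Box q, if RightOf h i then P h j n • v else 0)
        - ∑ h : Box q, if RightOf j h then P i h n • v else 0) := by
  have h1 : (∑ r : Box q with j.1 < r.1 ∧ r.1 ≤ i.1, normalMode (P r j) (E i r) n v)
      = (∑ r : Box q with j.1 < r.1 ∧ r.1 ≤ i.1, cutMode (E i r) (P r j) 0 n v)
        + (n : ℂ) • (cnt q j.1 i.1 : ℂ) • P i j (n - 1) • v := by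
    have : ∀ r ∈ Finset.univ.filter (fun r : Box q => j.1 < r.1 ∧ r.1 ≤ i.1),
        normalMode (P r j) (E i r) n v
          = cutMode (E i r) (P r j) 0 n v + n • P i j (n - 1) • v := by
      intro r hr
      simp only [Finset.mem_filter, Finset.mem_univ, true_and] at hr
      refine normalMode_flip (H.e_field _ _) (H.p_field _ _) (fun s t => ?_) n v
      rw [H.e_p i r r j hr.2 hr.1, if_pos rfl, if_neg, sub_zero]
      rintro rfl
      exact absurd hr.1 (not_lt.2 hr.2)
    rw [Finset.sum_congr rfl this, Finset.sum_add_distrib, Finset.sum_const]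
    congr 1
    rw [smul_comm (n : ℂ), Int.cast_smul_eq_zsmul, Nat.cast_smul_eq_nsmul]
    rfl
  have h2 : (n : ℂ) • coefC q α i j • P i j (n - 1) • v
      = (n : ℂ) • (cnt q j.1 i.1 : ℂ) • P i j (n - 1) • v
        - (if j.1 < i.1 then α i.1 • (-(n : ℂ)) • P i j (n - 1) • v else 0) := by
    unfold coefC
    split_ifs with h
    · generalize P i j (n - 1) • v = w
      module
    · rw [H.p_zero i j h]; simp
  unfold diffMode
  simp only [col]
  rw [h1, h2]
  simp only [← Finset.sum_filter]
  unfold normalMode cutMode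
  abel

theorem diff_comm (H : CurrentRel E P α M) (hα : ∀ s t, α s + q s = α t + q t)
    (a b i j : Box q) (hab : b.1 ≤ a.1) (hij : j.1 ≤ i.1) (m n : ℤ) (v : M) :
    E a b m • diffMode E P α i j n v - diffMode E P α i j n (E a b m • v) =
      ((∑ r : Box q, if j.1 ≤ r.1 ∧ r.1 < i.1 then
        ((if b = r then cutMode (E a j) (P i r) 0 (m + n) v else 0)
          - (if a = j then cutMode (E r b) (P i r) 0 (m + n) v else 0)
          + (if b = i then cutMode (E r j) (P a r) 0 (m + n) v else 0)
          - (if a = r then cutMode (E r j) (P i b) 0 (m + n) v else 0)) else 0)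
      - ∑ r : Box q, if j.1 < r.1 ∧ r.1 ≤ i.1 then
        ((if b = i then cutMode (E a r) (P r j) 0 (m + n) v else 0)
          - (if a = r then cutMode (E i b) (P r j) 0 (m + n) v else 0)
          + (if b = r then cutMode (E i r) (P a j) 0 (m + n) v else 0)
          - (if a = j then cutMode (E i r) (P r b) 0 (m + n) v else 0)) else 0)
      + (m : ℂ) • ((if b = i then (coefC q α a b - coefC q α a j) • P a j (m + n - 1) • v else 0)
        + (if a = j then (coefC q α i b - coefC q α a b) • P i b (m + n - 1) • v else 0))
      - (n : ℂ) • coefC q α i j • ((if b = i then P a j (m + n - 1) • v else 0)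
        - (if a = j then P i b (m + n - 1) • v else 0))
      + ((∑ h : Box q, if RightOf h i then
        ((if b = h then P a j (m + n) • v else 0) - (if a = j then P h b (m + n) • v else 0)) else 0)
      - ∑ h : Box q, if RightOf j h then
        ((if b = i then P a h (m + n) • v else 0) - (if a = h then P i b (m + n) • v else 0)) else 0)
      := by
  have hfo := first_order (q := q) (M := M) α hα (fun i j => P i j (m + n - 1) • v)
    (fun i j h => by rw [H.p_zero i j h]; simp) a b i j hab hij (coefC q α) (fun _ _ => rfl)
  have hP : ∀ (i j : Box q) (n' : ℤ), j.1 < i.1 →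
      E a b m • P i j n' • v - P i j n' • E a b m • v =
      (if b = i then P a j (m + n') • v else 0) - (if a = j then P i b (m + n') • v else 0) := by
    intro i j n' h
    have := congrArg (· • v) (H.e_p a b i j hab h m n')
    simp only [sub_smul, mul_smul] at this
    rw [this]
    congr 1 <;> split_ifs <;> simp
  have t1 : ∀ r : Box q, E a b m • (if j.1 ≤ r.1 ∧ r.1 < i.1 then cutMode (E r j) (P i r) 0 n v else 0)
      - (if j.1 ≤ r.1 ∧ r.1 < i.1 then cutMode (E r j) (P i r) 0 n (E a b m • v) else 0)
      = (if j.1 ≤ r.1 ∧ r.1 < i.1 then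
        ((if b = r then cutMode (E a j) (P i r) 0 (m + n) v else 0)
          - (if a = j then cutMode (E r b) (P i r) 0 (m + n) v else 0)
          + (if b = i then cutMode (E r j) (P a r) 0 (m + n) v else 0)
          - (if a = r then cutMode (E r j) (P i b) 0 (m + n) v else 0)) else 0)
        + (m : ℂ) • (if j.1 ≤ r.1 ∧ r.1 < i.1 then
        ((if b = r then (if j = i then P a r (m + n - 1) • v else 0)
            - (if a = r then P i j (m + n - 1) • v else 0) else 0)
        - (if a = j then (if b = i then P r r (m + n - 1) • v else 0)
            - (if r = r then P i b (m + n - 1) • v else 0) else 0)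
        + formB α a b r j • P i r (m + n - 1) • v) else 0) := by
    intro r
    by_cases h : j.1 ≤ r.1 ∧ r.1 < i.1
    · rw [if_pos h, if_pos h, if_pos h, if_pos h]
      exact normal_comm H a b r j i r hab h.1 h.2 m n v
    · simp [h]
  have t2 : ∀ r : Box q, E a b m • (if j.1 < r.1 ∧ r.1 ≤ i.1 then cutMode (E i r) (P r j) 0 n v else 0)
      - (if j.1 < r.1 ∧ r.1 ≤ i.1 then cutMode (E i r) (P r j) 0 n (E a b m • v) else 0)
      = (if j.1 < r.1 ∧ r.1 ≤ i.1 then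
        ((if b = i then cutMode (E a r) (P r j) 0 (m + n) v else 0)
          - (if a = r then cutMode (E i b) (P r j) 0 (m + n) v else 0)
          + (if b = r then cutMode (E i r) (P a j) 0 (m + n) v else 0)
          - (if a = j then cutMode (E i r) (P r b) 0 (m + n) v else 0)) else 0)
        + (m : ℂ) • (if j.1 < r.1 ∧ r.1 ≤ i.1 then
        ((if b = i then (if r = r then P a j (m + n - 1) • v else 0)
            - (if a = j then P r r (m + n - 1) • v else 0) else 0)
        - (if a = r then (if b = r then P i j (m + n - 1) • v else 0)
            - (if i = j then P r b (m + n - 1) • v else 0) else 0)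
        + formB α a b i r • P r j (m + n - 1) • v) else 0) := by
    intro r
    by_cases h : j.1 < r.1 ∧ r.1 ≤ i.1
    · rw [if_pos h, if_pos h, if_pos h, if_pos h]
      exact normal_comm H a b i r r j hab h.2 h.1 m n v
    · simp [h]
  have t3 : E a b m • (n : ℂ) • coefC q α i j • P i j (n - 1) • v
      - (n : ℂ) • coefC q α i j • P i j (n - 1) • E a b m • v
      = (n : ℂ) • coefC q α i j • ((if b = i then P a j (m + n - 1) • v else 0)
        - (if a = j then P i b (m + n - 1) • v else 0)) := by
    by_cases h : j.1 < i.1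
    · have := hP i j (n - 1) h
      rw [← add_sub_assoc] at this
      rw [← this, smul_algebra_smul_comm, smul_algebra_smul_comm, smul_sub, smul_sub]
    · simp [coefC, h]
  have t4 : ∀ h : Box q, E a b m • (if RightOf h i then P h j n • v else 0)
      - (if RightOf h i then P h j n • E a b m • v else 0) =
      (if RightOf h i then
        ((if b = h then P a j (m + n) • v else 0) - (if a = j then P h b (m + n) • v else 0)) else 0)
      := by
    intro h
    by_cases hh : RightOf h i
    · rw [if_pos hh, if_pos hh, if_pos hh]
      exact hP h j n (by
        have := hh.2
        simp only [col, Fin.le_def, Fin.lt_def] at *; omega)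
    · simp [hh]
  have t5 : ∀ h : Box q, E a b m • (if RightOf j h then P i h n • v else 0)
      - (if RightOf j h then P i h n • E a b m • v else 0) =
      (if RightOf j h then
        ((if b = i then P a h (m + n) • v else 0) - (if a = h then P i b (m + n) • v else 0)) else 0)
      := by
    intro h
    by_cases hh : RightOf j h
    · rw [if_pos hh, if_pos hh, if_pos hh]
      exact hP i h n (by
        have := hh.2
        simp only [col, Fin.le_def, Fin.lt_def] at *; omega)
    · simp [hh]
  have s1 := Finset.sum_congr rfl fun r (_ : r ∈ Finset.univ) => t1 r
  have s2 := Finset.sum_congr rfl fun r (_ : r ∈ Finset.univ) => t2 r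
  have s4 := Finset.sum_congr rfl fun r (_ : r ∈ Finset.univ) => t4 r
  have s5 := Finset.sum_congr rfl fun r (_ : r ∈ Finset.univ) => t5 r
  rw [Finset.sum_add_distrib, Finset.sum_sub_distrib, ← Finset.smul_sum, ← Finset.smul_sum] at s1 s2
  rw [Finset.sum_sub_distrib, ← Finset.smul_sum] at s4 s5
  rw [diffMode_eq H, diffMode_eq H, ← hfo, smul_sub (m : ℂ), smul_add (E a b m), smul_sub (E a b m),
    smul_sub (E a b m), smul_sub (E a b m), ← s4, ← s5, ← t3]
  rw [← sub_eq_iff_eq_add] at s1 s2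
  rw [← s1, ← s2]
  abel

theorem diff_key (H : CurrentRel E P α M) (hα : ∀ s t, α s + q s = α t + q t)
    (a b i j : Box q) (hab : b.1 ≤ a.1) (hij : j.1 ≤ i.1) (m n : ℤ) (v : M) :
    (diffMode E P α a b m (E i j n • v) + E a b m • diffMode E P α i j n v)
      - (diffMode E P α i j n (E a b m • v) + E i j n • diffMode E P α a b m v)
    = (if b = i then diffMode E P α a j (m + n) v else 0)
      - (if a = j then diffMode E P α i b (m + n) v else 0) := by
  have k1 := diff_comm H hα a b i j hab hij m n v
  have k2 := diff_comm H hα i j a b hij hab n m v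
  rw [add_comm n m] at k2
  have hq := quad_identity (fun c d i j => cutMode (E c d) (P i j) 0 (m + n) v) (by
      intro c d i j h
      rw [not_and_or] at h
      rcases h with h | h
      · simp only [H.e_zero c d h, cutMode_zero_left]
      · simp only [H.p_zero i j h, cutMode_zero_right]) a b i j hab hij _ (fun _ _ _ _ => rfl) _
      (fun _ _ => rfl)
  have hl := lin_identity (fun i j => P i j (m + n) • v) a b i j _ (fun _ _ _ _ => rfl) _
      (fun _ _ => rfl)
  have hf : ((m : ℂ) • ((if b = i then (coefC q α a b - coefC q α a j) • P a j (m + n - 1) • v else 0)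
        + (if a = j then (coefC q α i b - coefC q α a b) • P i b (m + n - 1) • v else 0))
      - (n : ℂ) • coefC q α i j • ((if b = i then P a j (m + n - 1) • v else 0)
        - (if a = j then P i b (m + n - 1) • v else 0)))
     - ((n : ℂ) • ((if j = a then (coefC q α i j - coefC q α i b) • P i b (m + n - 1) • v else 0)
        + (if i = b then (coefC q α a j - coefC q α i j) • P a j (m + n - 1) • v else 0))
      - (m : ℂ) • coefC q α a b • ((if j = a then P i b (m + n - 1) • v else 0)
        - (if i = b then P a j (m + n - 1) • v else 0)))
     = (if b = i then - (((m + n : ℤ) : ℂ) • coefC q α a j • P a j (m + n - 1) • v) else 0)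
      - (if a = j then - (((m + n : ℤ) : ℂ) • coefC q α i b • P i b (m + n - 1) • v) else 0) := by
    push_cast
    generalize P a j (m + n - 1) • v = w
    generalize P i b (m + n - 1) • v = w'
    by_cases h1 : b = i <;> by_cases h2 : a = j
    · subst h1; subst h2; simp only [if_true]; module
    · subst h1; simp only [if_true, h2, Ne.symm h2, if_false]; module
    · subst h2; simp only [if_true, h1, Ne.symm h1, if_false]; module
    · simp only [h1, h2, Ne.symm h1, Ne.symm h2, if_false]; module
  have r1 : ∀ (Z Z' : Prop) [Decidable Z] [Decidable Z'] (x y z x' y' z' : M),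
      (if Z then (x - y) + z else 0) - (if Z' then (x' - y') + z' else 0)
      = ((if Z then x else 0) - (if Z' then x' else 0))
        + ((if Z then -y else 0) - (if Z' then -y' else 0))
        + ((if Z then z else 0) - (if Z' then z' else 0)) := by
    intro Z Z' _ _ x y z x' y' z'
    split_ifs <;> abel
  rw [diffMode_eq H a j (m + n) v, diffMode_eq H i b (m + n) v, r1, ← hq, ← hf, ← hl]
  have e : ∀ x y z w : M, (x + y) - (z + w) = (y - z) - (w - x) := by intros; abel
  rw [e, k1, k2]
  have fin : ∀ x1 x2 x3 x4 y1 y2 y3 y4 : M, (x1 + x2 - x3 + x4) - (y1 + y2 - y3 + y4)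
      = (x1 - y1) + ((x2 - x3) - (y2 - y3)) + (x4 - y4) := by intros; abel
  exact fin _ _ _ _ _ _ _ _

end Differential

section Construction

variable {B : Type} (odd : B → Bool) (br : B → B → B →₀ ℂ) (form : B → B → ℂ)

theorem mode_comm (x y : B) (m n : ℤ) :
    mode odd br form x m * mode odd br form y n
      - (if odd x && odd y then (-1 : ℂ) else 1) • (mode odd br form y n * mode odd br form x m)
    = current odd br form (br x y) (m + n)
      + algebraMap ℂ _ (if m + n = 0 then m * form x y else 0) := by
  have h : ofFree odd br form _ = ofFree odd br form _ :=
    RingQuot.mkAlgHom_rel ℂ (AffineRel.comm (odd := odd) (br := br) (form := form) x y m n)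
  simp only [map_sub, map_smul, map_mul, map_add, AlgHom.commutes] at h
  unfold mode current
  rw [h]
  congr 1
  exact Finsupp.apply_linearCombination ℂ (ofFree odd br form).toLinearMap _ _

theorem mode_vac (x : B) (n : ℤ) (hn : 0 ≤ n) :
    mode odd br form x n • vac odd br form = 0 := by
  unfold vac
  rw [← Submodule.Quotient.mk_smul, smul_eq_mul, mul_one, Submodule.Quotient.mk_eq_zero]
  exact Submodule.subset_span ⟨x, n, hn, rfl⟩

theorem current_smul_eq_zero (u : B →₀ ℂ) (n : ℤ) (v : UniversalAffine odd br form)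
    (h : ∀ x, mode odd br form x n • v = 0) : current odd br form u n • v = 0 := by
  unfold current
  rw [Finsupp.linearCombination_apply, Finsupp.sum, Finset.sum_smul]
  exact Finset.sum_eq_zero fun x _ => by rw [smul_assoc, h, smul_zero]

theorem exists_bound (v : UniversalAffine odd br form) :
    ∃ K : ℤ, ∀ (x : B) (n : ℤ), K ≤ n → mode odd br form x n • v = 0 := by
  have main : ∀ (a : FreeAlgebra ℂ (B × ℤ)) (v : UniversalAffine odd br form),
      (∃ K : ℤ, ∀ (x : B) (n : ℤ), K ≤ n → mode odd br form x n • v = 0) →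
      ∃ K : ℤ, ∀ (x : B) (n : ℤ), K ≤ n → mode odd br form x n •
        (ofFree odd br form a) • v = 0 := by
    intro a
    induction a using FreeAlgebra.induction with
    | grade0 c =>
      rintro v ⟨K, hK⟩
      refine ⟨K, fun x n hn => ?_⟩
      rw [AlgHom.commutes, algebraMap_smul, smul_algebra_smul_comm, hK x n hn, smul_zero]
    | grade1 y =>
      obtain ⟨y, m⟩ := y
      rintro v ⟨K, hK⟩
      refine ⟨max K (max (K - m) (1 - m)), fun x n hn => ?_⟩
      have h := congrArg (· • v) (mode_comm odd br form x y n m)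
      simp only [sub_smul, mul_smul, add_smul, smul_assoc] at h
      rw [hK x n (by omega), smul_zero, smul_zero, sub_zero, if_neg (by omega), map_zero,
        zero_smul, add_zero, current_smul_eq_zero _ _ _ _ _ _ fun z => hK z (n + m) (by omega)] at h
      exact h
    | mul a b ha hb =>
      intro v hv
      rw [map_mul]
      simp only [mul_smul]
      exact ha _ (hb _ hv)
    | add a b ha hb =>
      intro v hv
      obtain ⟨K, hK⟩ := ha v hv
      obtain ⟨L, hL⟩ := hb v hv
      refine ⟨max K L, fun x n hn => ?_⟩
      rw [map_add, add_smul, smul_add, hK x n (by omega), hL x n (by omega), add_zero]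
  obtain ⟨a, rfl⟩ := Submodule.Quotient.mk_surjective _ v
  obtain ⟨a, rfl⟩ := (show Function.Surjective (ofFree odd br form) from
    RingQuot.mkAlgHom_surjective ℂ (AffineRel odd br form)) a
  have := main a (vac odd br form) ⟨0, fun x n hn => mode_vac odd br form x n hn⟩
  unfold vac at this
  simpa only [← Submodule.Quotient.mk_smul, smul_eq_mul, mul_one] using this

theorem current_truncated (u : B →₀ ℂ) :
    Truncated (UniversalAffine odd br form) (current odd br form u) := by
  intro v
  obtain ⟨K, hK⟩ := exists_bound odd br form v
  exact ⟨K, fun n hn => current_smul_eq_zero _ _ _ _ _ _ fun x => hK x n hn⟩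

theorem current_vac (u : B →₀ ℂ) (n : ℤ) (hn : 0 ≤ n) :
    current odd br form u n • vac odd br form = 0 :=
  current_smul_eq_zero _ _ _ _ _ _ fun x => mode_vac odd br form x n hn

end Construction

section Differential

variable {l : ℕ} {q : Fin l → ℕ} (k : ℂ)

theorem currentRel : CurrentRel (modeE (q := q) k) (modePsi k) (alpha q k) (VA q k) where
  e_field i j := current_truncated _ _ _ _
  p_field i j := current_truncated _ _ _ _
  p_zero i j h := by
    funext n
    simp only [modePsi, psiA, dif_neg h, current, map_zero, Pi.zero_apply]
  e_zero i j h := by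
    funext n
    simp only [modeE, eA, dif_neg h, current, map_zero, Pi.zero_apply]
  e_e a b i j hab hij m n := by
    have h := mode_comm (oddA (q := q)) brA (kappaA q k) (Sum.inl ⟨(a, b), hab⟩)
      (Sum.inl ⟨(i, j), hij⟩) m n
    simp only [oddA, Bool.and_self, Bool.false_eq_true, if_false, one_smul] at h
    simp only [modeE]
    rw [show eA a b = Finsupp.single (Sum.inl ⟨(a, b), hab⟩) 1 from dif_pos hab,
      show eA i j = Finsupp.single (Sum.inl ⟨(i, j), hij⟩) 1 from dif_pos hij]
    simp only [current, Finsupp.linearCombination_single, one_smul] at h ⊢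
    rw [h]
    simp only [brA, kappaA, kappaB, map_sub]
    congr 2 <;> split_ifs <;> simp
  e_p a b i j hab hij m n := by
    have h := mode_comm (oddA (q := q)) brA (kappaA q k) (Sum.inl ⟨(a, b), hab⟩)
      (Sum.inr ⟨(i, j), hij⟩) m n
    simp only [oddA, Bool.false_and, Bool.false_eq_true, if_false, one_smul] at h
    simp only [modeE, modePsi]
    rw [show eA a b = Finsupp.single (Sum.inl ⟨(a, b), hab⟩) 1 from dif_pos hab,
      show psiA i j = Finsupp.single (Sum.inr ⟨(i, j), hij⟩) 1 from dif_pos hij]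
    simp only [current, Finsupp.linearCombination_single, one_smul] at h ⊢
    rw [h]
    simp only [brA, kappaA, map_sub, mul_zero, ite_self, map_zero, add_zero]
    congr 1 <;> split_ifs <;> simp

theorem alpha_add (s t : Fin l) : alpha q k s + q s = alpha q k t + q t := by
  simp [alpha]

/-- The `n`-th mode of the image of `e_{i,j}[-1]` under the differential, on `V^κ̃(𝔞)`. -/
def diffOp (i j : Box q) (n : ℤ) : VA q k →ₗ[ℂ] VA q k where
  toFun := diffMode (modeE k) (modePsi k) (alpha q k) i j n
  map_add' v w := by
    have H := currentRel (q := q) k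
    have h := fun c d a b => cutMode_add (H.e_field c d) (H.p_field a b) 0 n v w
    have h' := fun c d a b => cutMode_add (H.p_field a b) (H.e_field c d) 0 n v w
    have e : ∀ x y : ℤ → AlgA q k, ∀ v : VA q k, normalMode x y n v = cutMode x y 0 n v :=
      fun _ _ _ => rfl
    unfold diffMode
    simp only [e, h, h', smul_add, Finset.sum_add_distrib]
    split_ifs <;> abel
  map_smul' c v := by
    have H := currentRel (q := q) k
    have h := fun s d a b => cutMode_smul (H.e_field s d) (H.p_field a b) 0 n c v
    have h' := fun s d a b => cutMode_smul (H.p_field a b) (H.e_field s d) 0 n c v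
    have e : ∀ x y : ℤ → AlgA q k, ∀ v : VA q k, normalMode x y n v = cutMode x y 0 n v :=
      fun _ _ _ => rfl
    have hs : ∀ a : AlgA q k, a • c • v = c • a • v := fun a => smul_algebra_smul_comm _ _ _
    unfold diffMode
    simp only [e, h, h', hs, RingHom.id_apply, ← Finset.smul_sum, smul_sub, smul_add]
    congr 3
    generalize modePsi k i j (n - 1) • v = w
    split_ifs
    · module
    · rw [smul_zero]

/-- The operator `(v, w) ↦ (e_{i,j}tⁿ v, (d e_{i,j})₍ₙ₎ v + e_{i,j}tⁿ w)` attached to a basis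
element of `𝔟`. -/
def pairOp (x : BasisB q) (n : ℤ) : Module.End ℂ (VA q k × VA q k) :=
  ((Module.toModuleEnd ℂ (VA q k) (modeE k x.1.1 x.1.2 n)).comp (LinearMap.fst ℂ _ _)).prod
    ((diffOp k x.1.1 x.1.2 n).comp (LinearMap.fst ℂ _ _)
      + (Module.toModuleEnd ℂ (VA q k) (modeE k x.1.1 x.1.2 n)).comp (LinearMap.snd ℂ _ _))

theorem pairOp_apply (x : BasisB q) (n : ℤ) (v w : VA q k) :
    pairOp k x n (v, w) = (modeE k x.1.1 x.1.2 n • v,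
      diffMode (modeE k) (modePsi k) (alpha q k) x.1.1 x.1.2 n v + modeE k x.1.1 x.1.2 n • w) :=
  rfl

theorem lin_eB {N : Type*} [AddCommGroup N] [Module ℂ N] (f : BasisB q → N) (i j : Box q)
    (h : col j ≤ col i) : Finsupp.linearCombination ℂ f (eB i j) = f ⟨(i, j), h⟩ := by
  rw [eB, dif_pos h, Finsupp.linearCombination_single, one_smul]

theorem pairOp_comm (x y : BasisB q) (m n : ℤ) :
    pairOp k x m * pairOp k y n - pairOp k y n * pairOp k x m
      = Finsupp.linearCombination ℂ (fun z => pairOp k z (m + n)) (brB x y)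
        + algebraMap ℂ _ (if m + n = 0 then m * kappaB q k x y else 0) := by
  obtain ⟨⟨a, b⟩, hab⟩ := x
  obtain ⟨⟨i, j⟩, hij⟩ := y
  simp only at hab hij
  have H := currentRel (q := q) k
  refine LinearMap.ext fun ⟨v, w⟩ => ?_
  have hbr : Finsupp.linearCombination ℂ (fun z => pairOp k z (m + n))
      (brB ⟨(a, b), hab⟩ ⟨(i, j), hij⟩) (v, w) =
      (if b = i then (modeE k a j (m + n) • v,
        diffMode (modeE k) (modePsi k) (alpha q k) a j (m + n) v + modeE k a j (m + n) • w) else 0)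
      - (if a = j then (modeE k i b (m + n) • v,
        diffMode (modeE k) (modePsi k) (alpha q k) i b (m + n) v + modeE k i b (m + n) • w) else 0)
      := by
    rw [brB, map_sub, LinearMap.sub_apply]
    congr 1
    · split_ifs with h
      · have h' : b = i := h
        rw [lin_eB _ a j (by subst h'; exact hij.trans hab), pairOp_apply]
      · rw [map_zero, LinearMap.zero_apply]
    · split_ifs with h
      · have h' : a = j := h
        rw [lin_eB _ i b (by subst h'; exact hab.trans hij), pairOp_apply]
      · rw [map_zero, LinearMap.zero_apply]
  have hE : ∀ v : VA q k, modeE k a b m • modeE k i j n • v - modeE k i j n • modeE k a b m • v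
      = ((if b = i then modeE k a j (m + n) • v else 0)
        - (if a = j then modeE k i b (m + n) • v else 0))
        + (if m + n = 0 then (m : ℂ) * formB (alpha q k) a b i j else 0) • v := by
    intro v
    have := congrArg (· • v) (H.e_e a b i j hab hij m n)
    simp only [sub_smul, mul_smul, add_smul, algebraMap_smul] at this
    rw [this]
    congr 2 <;> split_ifs <;> simp
  have hk := diff_key H (fun s t => alpha_add k s t) a b i j hab hij m n v
  rw [LinearMap.sub_apply, LinearMap.add_apply, hbr, Module.End.mul_apply, Module.End.mul_apply,
    pairOp_apply, pairOp_apply, pairOp_apply, pairOp_apply, Module.algebraMap_end_apply]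
  simp only [kappaB]
  refine Prod.ext ?_ ?_
  · have := hE v
    simp only [Prod.fst_sub, Prod.fst_add, Prod.smul_fst, apply_ite Prod.fst, Prod.fst_zero]
    exact this
  · have hw := hE w
    simp only [Prod.snd_sub, Prod.snd_add, Prod.smul_snd, apply_ite Prod.snd, Prod.snd_zero,
      smul_add]
    have r1 : ∀ (Z Z' : Prop) [Decidable Z] [Decidable Z'] (x y x' y' : VA q k),
        (if Z then x + y else 0) - (if Z' then x' + y' else 0)
        = ((if Z then x else 0) - (if Z' then x' else 0))
          + ((if Z then y else 0) - (if Z' then y' else 0)) := by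
      intro Z Z' _ _ x y x' y'
      split_ifs <;> abel
    rw [r1, add_assoc, ← hw, ← hk]
    abel

/-- The action of the modes of `𝔟` on pairs `(v, w)` given by `pairOp`. -/
def pairHom : AlgB q k →ₐ[ℂ] Module.End ℂ (VA q k × VA q k) :=
  RingQuot.liftAlgHom ℂ ⟨FreeAlgebra.lift ℂ (fun z : BasisB q × ℤ => pairOp k z.1 z.2), by
    rintro _ _ ⟨x, y, m, n⟩
    have h := Finsupp.apply_linearCombination ℂ
      (FreeAlgebra.lift ℂ (fun z : BasisB q × ℤ => pairOp k z.1 z.2)).toLinearMap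
      (fun z => FreeAlgebra.ι ℂ (z, m + n)) (brB x y)
    simp only [AlgHom.toLinearMap_apply] at h
    rw [map_add, map_sub, map_smul, map_mul, map_mul, AlgHom.commutes, h]
    simp only [FreeAlgebra.lift_ι_apply, oddB, Bool.and_self, Bool.false_eq_true, if_false, one_smul]
    rw [pairOp_comm]
    congr 3
    funext z
    simp⟩

theorem pairHom_mode (x : BasisB q) (n : ℤ) :
    pairHom k (mode oddB brB (kappaB q k) x n) = pairOp k x n := by
  refine (RingQuot.liftAlgHom_mkAlgHom_apply ℂ _ _ _).trans ?_
  rw [FreeAlgebra.lift_ι_apply]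

theorem normalMode_vac (x y : ℤ → AlgA q k) (hx : ∀ n, 0 ≤ n → x n • vacA q k = 0)
    (hy : ∀ n, 0 ≤ n → y n • vacA q k = 0) (n : ℤ) (hn : 0 ≤ n) :
    normalMode x y n (vacA q k) = 0 := by
  unfold normalMode
  refine (finsum_congr fun j => ?_).trans finsum_zero
  split_ifs with h
  · rw [hy _ (by omega), smul_zero]
  · rw [hx _ (by omega), smul_zero]

theorem diffMode_vac (i j : Box q) (n : ℤ) (hn : 0 ≤ n) :
    diffMode (modeE k) (modePsi k) (alpha q k) i j n (vacA q k) = 0 := by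
  have hE : ∀ (i j : Box q) (n : ℤ), 0 ≤ n → modeE k i j n • vacA q k = 0 :=
    fun i j n hn => current_vac _ _ _ _ n hn
  have hP : ∀ (i j : Box q) (n : ℤ), 0 ≤ n → modePsi k i j n • vacA q k = 0 :=
    fun i j n hn => current_vac _ _ _ _ n hn
  have h1 : -(n : ℂ) • modePsi k i j (n - 1) • vacA q k = 0 := by
    rcases hn.eq_or_lt with h | h
    · rw [← h]; simp
    · rw [hP _ _ _ (by omega), smul_zero]
  unfold diffMode
  rw [h1, Finset.sum_eq_zero, Finset.sum_eq_zero, Finset.sum_eq_zero, Finset.sum_eq_zero]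
  · simp
  · exact fun h _ => hP _ _ _ hn
  · exact fun h _ => hP _ _ _ hn
  · exact fun r _ => normalMode_vac k _ _ (hP r j) (hE i r) n hn
  · exact fun r _ => normalMode_vac k _ _ (hE r j) (hP i r) n hn

theorem pairHom_ideal (a : AlgB q k) (ha : a ∈ vacuumIdeal (oddB (q := q)) brB (kappaB q k)) :
    pairHom k a (vacA q k, 0) = 0 := by
  induction ha using Submodule.span_induction with
  | mem a h =>
    obtain ⟨x, n, hn, rfl⟩ := h
    rw [pairHom_mode, pairOp_apply, diffMode_vac k _ _ n hn, smul_zero, add_zero]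
    refine Prod.ext ?_ rfl
    exact current_vac _ _ _ _ n hn
  | zero => rw [map_zero, LinearMap.zero_apply]
  | add a b _ _ ha hb => rw [map_add, LinearMap.add_apply, ha, hb, add_zero]
  | smul c a _ ha => rw [smul_eq_mul, map_mul, Module.End.mul_apply, ha, map_zero]

/-- The map `V^κ(𝔟) → V^κ̃(𝔞) × V^κ̃(𝔞)` whose components are the natural map and the
differential. -/
def pairMap : VB q k →ₗ[ℂ] VA q k × VA q k :=
  (Submodule.liftQ ((vacuumIdeal (oddB (q := q)) brB (kappaB q k)).restrictScalars ℂ)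
    ((LinearMap.applyₗ (vacA q k, (0 : VA q k))).comp (pairHom k).toLinearMap)
    (fun a ha => pairHom_ideal k a ha)).comp
  (Submodule.Quotient.restrictScalarsEquiv ℂ _).symm.toLinearMap

theorem pairMap_mk (a : AlgB q k) :
    pairMap k (Submodule.Quotient.mk a) = pairHom k a (vacA q k, 0) := rfl

theorem pairMap_mode (x : BasisB q) (n : ℤ) (v : VB q k) :
    pairMap k (mode oddB brB (kappaB q k) x n • v) = pairOp k x n (pairMap k v) := by
  obtain ⟨a, rfl⟩ := Submodule.Quotient.mk_surjective _ v
  rw [← Submodule.Quotient.mk_smul, pairMap_mk, pairMap_mk, smul_eq_mul, map_mul, pairHom_mode,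
    Module.End.mul_apply]

theorem modeB_eq (i j : Box q) (h : col j ≤ col i) (n : ℤ) :
    modeB k i j n = mode oddB brB (kappaB q k) ⟨(i, j), h⟩ n :=
  lin_eB _ _ _ _

end Differential

section Main

variable {l : ℕ} (q : Fin l → ℕ) (k : ℂ)

/-- The natural map `V^κ(𝔟) → V^κ̃(𝔞)`, an inclusion by the PBW theorem. -/
def incl : VB q k →ₗ[ℂ] VA q k := (LinearMap.fst ℂ _ _).comp (pairMap k)

/-- The differential `d₀ : V^κ(𝔟) → V^κ̃(𝔞)`. It is characterized by the facts `dZero_vac` and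
`dZero_mode` below: it annihilates the vacuum, and it is a derivation for all modes of the
generating fields `e_{i,j}`, with the prescribed value on `e_{i,j}[-1]`. -/
def dZero : VB q k →ₗ[ℂ] VA q k := (LinearMap.snd ℂ _ _).comp (pairMap k)

/-- The `W`-algebra `W^k(gl(N), f) = {y ∈ V^κ(𝔟) ∣ d₀ y = 0}`. -/
def WAlgebra : Submodule ℂ (VB q k) := LinearMap.ker (dZero q k)

variable {q}

theorem incl_vac : incl q k (vacB q k) = vacA q k := by
  change (pairMap k (Submodule.Quotient.mk 1)).1 = _
  rw [pairMap_mk, map_one]; rfl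

theorem incl_mode (i j : Box q) (h : col j ≤ col i) (n : ℤ) (v : VB q k) :
    incl q k (modeB k i j n • v) = modeE k i j n • incl q k v := by
  rw [modeB_eq k i j h]
  exact congrArg Prod.fst (pairMap_mode k ⟨(i, j), h⟩ n v)

theorem dZero_vac : dZero q k (vacB q k) = 0 := by
  change (pairMap k (Submodule.Quotient.mk 1)).2 = _
  rw [pairMap_mk, map_one]; rfl

theorem dZero_mode (i j : Box q) (h : col j ≤ col i) (n : ℤ) (v : VB q k) :
    dZero q k (modeB k i j n • v) =
      diffMode (modeE k) (modePsi k) (alpha q k) i j n (incl q k v)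
        + modeE k i j n • dZero q k v := by
  rw [modeB_eq k i j h]
  exact congrArg Prod.snd (pairMap_mode k ⟨(i, j), h⟩ n v)

/-! ### The elements `W⁽¹⁾` and `W⁽²⁾`

Here `e_{i,j}[-s]` is `e_{i,j} t⁻ˢ` applied to the vacuum, and the product
`e_{u,j}[-1] e_{i,v}[-1]` is `e_{u,j} t⁻¹ e_{i,v} t⁻¹` applied to the vacuum. -/

variable (q)

/-- `W⁽¹⁾_{p,r} = ∑ e_{i,j}[-1]`, over `row i = p`, `row j = r`, `col i = col j`. -/
def W1 (p r : ℕ) : VB q k :=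
  ∑ i : Box q, ∑ j : Box q,
    if row i = p ∧ row j = r ∧ col i = col j then modeB k i j (-1) • vacB q k else 0

/-- `W⁽²⁾_{p,r}`; in all four sums `row i = p` and `row j = r`. -/
def W2 [NeZero l] (p r : ℕ) : VB q k :=
  (∑ i : Box q, ∑ j : Box q,
    if row i = p ∧ row j = r ∧ (col i : ℕ) = col j + 1 then modeB k i j (-1) • vacB q k else 0)
  - (∑ i : Box q, ∑ j : Box q,
    if row i = p ∧ row j = r ∧ col i = col j then
      gamma q k (col i) • modeB k i j (-2) • vacB q k else 0)
  + (∑ i : Box q, ∑ j : Box q, ∑ u : Box q, ∑ v : Box q,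
    if row i = p ∧ row j = r ∧ col u = col j ∧ col j < col i ∧ col i = col v ∧
        row u = row v ∧ row v ≤ q ⊤ then
      modeB k u j (-1) • modeB k i v (-1) • vacB q k else 0)
  - (∑ i : Box q, ∑ j : Box q, ∑ u : Box q, ∑ v : Box q,
    if row i = p ∧ row j = r ∧ col u = col j ∧ col j ≥ col i ∧ col i = col v ∧
        row u = row v ∧ row v > q ⊤ then
      modeB k u j (-1) • modeB k i v (-1) • vacB q k else 0)

end Main

end WAlg

end

/-! On an element `e_{i,j}` with `col i = col j` the differential has neither a quadratic nor an
`α`-term: it sends `e_{i,j}` to `ψ_{î,j} - ψ_{i,j̃}` (`diffMode_same_col`). Summing this over the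
pairs of boxes in two given rows, weighted by a function of the column, is a summation by parts
(`sum_rightOf_sub`): the shifted terms meet, and what remains is the difference of consecutive
weights. For a constant weight nothing remains, which gives `W⁽¹⁾`.

All terms of `W⁽²⁾` but those of the first sum are built from such elements. The first sum
contributes `∑ e_{v,j} ψ_{i,v} - ∑ ψ_{v,j} e_{i,v}` and `∑ α_{col i} ψ_{i,j}[-2]`, over
`col i = col j + 1`, and linear terms that telescope to zero. In the second sum the weight is `γ`, and
`γ_s - γ_{s+1} = α_{s+1}` cancels the `α`-terms. The two quadratic sums of `W⁽²⁾` form one sum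
(`W2_eq`), whose coefficient, as a function of the columns `s = col i` and `t = col j`, differs from
`[t < s]` by a constant depending on the row of `v` only (`quadCoeff`). Summation by parts in `t`
and in `s` therefore leaves exactly the terms with `t + 1 = s` (`sum_quad_left`) and with `s = t`
(`sum_quad_right`), which are the opposites of the quadratic terms above. No commutator enters,
since the products are already in the order in which the differential of the first sum has them. -/

namespace WAlg

variable {l : ℕ} {q : Fin l → ℕ}

/-! ### Telescoping over the pyramid -/

theorem box_ext {i j : Box q} (hrow : row i = row j) (hcol : (col i : ℕ) = col j) : i = j := by
  obtain ⟨s, a⟩ := i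
  obtain ⟨t, b⟩ := j
  obtain rfl : s = t := Fin.ext hcol
  obtain rfl : a = b := Fin.ext (by simpa [row] using hrow)
  rfl

theorem row_le (i : Box q) : row i ≤ q (col i) := i.2.isLt

theorem exists_box {s a : ℕ} (hs : s < l) (ha : 1 ≤ a) (haq : a ≤ q ⟨s, hs⟩) :
    ∃ i : Box q, row i = a ∧ (col i : ℕ) = s :=
  ⟨⟨⟨s, hs⟩, ⟨a - 1, by omega⟩⟩, by simp only [row]; omega, rfl⟩

theorem sum_ite_unique {ι M : Type*} [Fintype ι] [AddCommMonoid M] (P : ι → Prop) [DecidablePred P]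
    (Q : Prop) [Decidable Q] (x : M) (huniq : ∀ i j, P i → P j → i = j) (hex : Q ↔ ∃ i, P i) :
    (∑ i, if P i then x else 0) = if Q then x else 0 := by
  split_ifs with h
  · obtain ⟨i, hi⟩ := hex.1 h
    rw [Finset.sum_eq_single i, if_pos hi]
    · exact fun j _ hj => if_neg fun h' => hj (huniq _ _ h' hi)
    · simp
  · exact Finset.sum_eq_zero fun i _ => if_neg fun h' => h (hex.2 ⟨i, h'⟩)

variable {M : Type*} [AddCommGroup M] [Module ℂ M]

/-- Moving the left end of a pair of boxes in the rows `p`, `r` one column further. -/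
theorem sum_rightOf_left (hq : Antitone q) (p r d : ℕ) (c : ℕ → ℂ) (f : Box q → Box q → M) :
    (∑ i : Box q, ∑ j : Box q, if row i = p ∧ row j = r ∧ (col i : ℕ) = col j + d then
      c (col j) • ∑ h : Box q with RightOf h i, f h j else 0)
    = ∑ i : Box q, ∑ j : Box q, if row i = p ∧ row j = r ∧ (col i : ℕ) = col j + (d + 1) then
      c (col j) • f i j else 0 := by
  have key : ∀ h j : Box q, (∑ i : Box q,
      if (row i = p ∧ row j = r ∧ (col i : ℕ) = col j + d) ∧ RightOf h i then c (col j) • f h j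
        else 0)
      = if row h = p ∧ row j = r ∧ (col h : ℕ) = col j + (d + 1) then c (col j) • f h j else 0 := by
    intro h j
    refine sum_ite_unique _ _ _ (fun i i' hi hi' => box_ext ?_ ?_) ⟨?_, ?_⟩
    · rw [hi.1.1, hi'.1.1]
    · rw [hi.1.2.2, hi'.1.2.2]
    · rintro ⟨h1, h2, h3⟩
      -- The column before that of `h` is at least as high, so it has a box in the row of `h`.
      have hh := h.1.isLt
      have hle := (row_le h).trans (hq (show (⟨col j + d, by omega⟩ : Fin l) ≤ col h from
        Fin.le_def.2 (by simp only; omega)))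
      obtain ⟨i, hi, hi'⟩ := exists_box (by omega) (by simp only [row]; omega) hle
      exact ⟨i, ⟨hi.trans h1, h2, hi'⟩, hi.symm, by omega⟩
    · rintro ⟨i, ⟨h1, h2, h3⟩, h4, h5⟩
      exact ⟨h4.trans h1, h2, by omega⟩
  simp only [← key]
  calc _ = ∑ i : Box q, ∑ j : Box q, ∑ h : Box q,
        if (row i = p ∧ row j = r ∧ (col i : ℕ) = col j + d) ∧ RightOf h i then c (col j) • f h j
          else 0 := by
        refine Finset.sum_congr rfl fun i _ => Finset.sum_congr rfl fun j _ => ?_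
        simp only [ite_and (_ ∧ _), Finset.sum_ite_irrel, Finset.sum_const_zero]
        rw [Finset.smul_sum, Finset.sum_filter]
    _ = _ := by
        rw [Finset.sum_comm]
        conv_rhs => rw [Finset.sum_comm]
        exact Finset.sum_congr rfl fun j _ => Finset.sum_comm

/-- Moving the right end of a pair of boxes in the rows `p`, `r` one column back. -/
theorem sum_rightOf_right (hq : Antitone q) (p r d : ℕ) (hr : 1 ≤ r) (c : ℕ → ℂ)
    (hc : ∀ s : Fin l, c s ≠ 0 → p ≤ q s → r ≤ q s) (f : Box q → Box q → M) :
    (∑ i : Box q, ∑ j : Box q, if row i = p ∧ row j = r ∧ (col i : ℕ) = col j + d then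
      c (col j) • ∑ h : Box q with RightOf j h, f i h else 0)
    = ∑ i : Box q, ∑ j : Box q, if row i = p ∧ row j = r ∧ (col i : ℕ) = col j + (d + 1) then
      c (col j + 1) • f i j else 0 := by
  have key : ∀ i h : Box q, (∑ j : Box q,
      if (row i = p ∧ row j = r ∧ (col i : ℕ) = col j + d) ∧ RightOf j h then
        c (col h + 1) • f i h else 0)
      = if row i = p ∧ row h = r ∧ (col i : ℕ) = col h + (d + 1) then
        c (col h + 1) • f i h else 0 := by
    intro i h
    by_cases h0 : c (col h + 1) = 0
    · simp [h0]
    refine sum_ite_unique _ _ _ (fun j j' hj hj' => box_ext ?_ ?_) ⟨?_, ?_⟩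
    · rw [hj.1.2.1, hj'.1.2.1]
    · rw [hj.2.2, hj'.2.2]
    · rintro ⟨h1, h2, h3⟩
      have hi := i.1.isLt
      have hle := (row_le i).trans (hq (show (⟨col h + 1, by omega⟩ : Fin l) ≤ col i from
        Fin.le_def.2 (by simp only; omega)))
      obtain ⟨j, hj, hj'⟩ := exists_box (by omega) hr (hc _ h0 (h1 ▸ hle))
      exact ⟨j, ⟨h1, hj, by omega⟩, hj.trans h2.symm, hj'⟩
    · rintro ⟨j, ⟨h1, h2, h3⟩, h4, h5⟩
      exact ⟨h1, h4.symm.trans h2, by omega⟩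
  simp only [← key]
  refine Finset.sum_congr rfl fun i _ => ?_
  rw [Finset.sum_comm]
  refine Finset.sum_congr rfl fun j _ => ?_
  rw [Finset.smul_sum, Finset.sum_filter]
  simp only [ite_and (_ ∧ _)]
  rw [Finset.sum_ite_irrel, Finset.sum_const_zero]
  refine if_congr Iff.rfl (Finset.sum_congr rfl fun h _ => ?_) rfl
  split_ifs with h'
  · rw [h'.2]
  · rfl

/-- Summation by parts along two rows `p`, `r` of the pyramid: the terms `f î j - f i j̃`, weighted
by a function `c` of the column of `j`, sum up to the differences of `c`. The condition on `c` says
that no term is lost because the row `r` has ended while the row `p` has not. -/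
theorem sum_rightOf_sub (hq : Antitone q) (p r d : ℕ) (hr : 1 ≤ r) (c : ℕ → ℂ)
    (hc : ∀ s : Fin l, c s ≠ 0 → p ≤ q s → r ≤ q s) (f : Box q → Box q → M) :
    (∑ i : Box q, ∑ j : Box q, if row i = p ∧ row j = r ∧ (col i : ℕ) = col j + d then
      c (col j) • ((∑ h : Box q with RightOf h i, f h j) - ∑ h : Box q with RightOf j h, f i h)
      else 0)
    = ∑ i : Box q, ∑ j : Box q, if row i = p ∧ row j = r ∧ (col i : ℕ) = col j + (d + 1) then
      (c (col j) - c (col j + 1)) • f i j else 0 := by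
  have hsub : ∀ (Z : Prop) [Decidable Z] (x y : M),
      (if Z then x - y else 0) = (if Z then x else 0) - (if Z then y else 0) := by
    intro Z _ x y; split_ifs <;> simp
  simp only [smul_sub, sub_smul, hsub, Finset.sum_sub_distrib]
  rw [sum_rightOf_left hq, sum_rightOf_right hq p r d hr c hc]

/-! ### The differential on the generators -/

variable (k : ℂ)

theorem modeE_vac (i j : Box q) (n : ℤ) (hn : 0 ≤ n) : modeE k i j n • vacA q k = 0 :=
  current_vac _ _ _ _ n hn

theorem modePsi_vac (i j : Box q) (n : ℤ) (hn : 0 ≤ n) : modePsi k i j n • vacA q k = 0 :=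
  current_vac _ _ _ _ n hn

theorem normalMode_neg_one_vac (x y : ℤ → AlgA q k) (hx : ∀ n, 0 ≤ n → x n • vacA q k = 0)
    (hy : ∀ n, 0 ≤ n → y n • vacA q k = 0) :
    normalMode x y (-1) (vacA q k) = x (-1) • y (-1) • vacA q k := by
  unfold normalMode
  rw [finsum_eq_single _ (-1)]
  · simp
  · intro j hj
    split_ifs with h
    · rw [hy _ (by omega), smul_zero]
    · rw [hx _ (by omega), smul_zero]

/-- Within one column the differential has no quadratic part. -/
theorem diffMode_same_col (i j : Box q) (h : (col i : ℕ) = col j) (n : ℤ) (v : VA q k) :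
    diffMode (modeE k) (modePsi k) (alpha q k) i j n v
      = (∑ h : Box q with RightOf h i, modePsi k h j n • v)
        - ∑ h : Box q with RightOf j h, modePsi k i h n • v := by
  have h : col i = col j := Fin.ext h
  unfold diffMode
  rw [Finset.sum_filter, Finset.sum_filter (fun r => col j < col r ∧ col r ≤ col i),
    Finset.sum_eq_zero, Finset.sum_eq_zero, if_neg (by rw [h]; exact lt_irrefl _)]
  · simp
  · exact fun r _ => if_neg fun h' => absurd (h'.1.trans_le h'.2) (by rw [h]; exact lt_irrefl _)
  · exact fun r _ => if_neg fun h' => absurd (h'.1.trans_lt h'.2) (by rw [h]; exact lt_irrefl _)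

/-- The differential of `e_{i,j}[-1]` when `i` is one column further than `j`. -/
theorem diffMode_next_col (i j : Box q) (h : (col i : ℕ) = col j + 1) :
    diffMode (modeE k) (modePsi k) (alpha q k) i j (-1) (vacA q k)
      = (∑ v : Box q with col v = col j, modeE k v j (-1) • modePsi k i v (-1) • vacA q k)
        - (∑ v : Box q with col v = col i, modePsi k v j (-1) • modeE k i v (-1) • vacA q k)
        + alpha q k (col i) • modePsi k i j (-2) • vacA q k
        + ((∑ h : Box q with RightOf h i, modePsi k h j (-1) • vacA q k)
        - ∑ h : Box q with RightOf j h, modePsi k i h (-1) • vacA q k) := by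
  have h1 : ∀ r : Box q, (col j ≤ col r ∧ col r < col i) ↔ col r = col j := fun r => by
    simp only [Fin.le_def, Fin.lt_def, Fin.ext_iff]; omega
  have h2 : ∀ r : Box q, (col j < col r ∧ col r ≤ col i) ↔ col r = col i := fun r => by
    simp only [Fin.le_def, Fin.lt_def, Fin.ext_iff]; omega
  have n1 : ∀ a b c d : Box q, normalMode (modeE k a b) (modePsi k c d) (-1) (vacA q k)
      = modeE k a b (-1) • modePsi k c d (-1) • vacA q k := fun a b c d =>
    normalMode_neg_one_vac k _ _ (modeE_vac k a b) (modePsi_vac k c d)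
  have n2 : ∀ a b c d : Box q, normalMode (modePsi k a b) (modeE k c d) (-1) (vacA q k)
      = modePsi k a b (-1) • modeE k c d (-1) • vacA q k := fun a b c d =>
    normalMode_neg_one_vac k _ _ (modePsi_vac k a b) (modeE_vac k c d)
  unfold diffMode
  rw [if_pos (Fin.lt_def.2 (by omega)), add_sub_assoc]
  simp only [h1, h2, n1, n2]
  norm_num

theorem dZero_modeB_vac (i j : Box q) (h : col j ≤ col i) (n : ℤ) :
    dZero q k (modeB k i j n • vacB q k)
      = diffMode (modeE k) (modePsi k) (alpha q k) i j n (vacA q k) := by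
  rw [dZero_mode k i j h, dZero_vac, smul_zero, add_zero, incl_vac]

theorem dZero_modeB_same_col (i j : Box q) (h : (col i : ℕ) = col j) (n : ℤ) :
    dZero q k (modeB k i j n • vacB q k)
      = (∑ h : Box q with RightOf h i, modePsi k h j n • vacA q k)
        - ∑ h : Box q with RightOf j h, modePsi k i h n • vacA q k := by
  rw [dZero_modeB_vac k i j (Fin.le_def.2 h.ge), diffMode_same_col k i j h]

theorem dZero_modeB_modeB_same_col (u j i v : Box q) (h : (col u : ℕ) = col j)
    (h' : (col i : ℕ) = col v) :
    dZero q k (modeB k u j (-1) • modeB k i v (-1) • vacB q k)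
      = ((∑ h : Box q with RightOf h u, modePsi k h j (-1) • modeE k i v (-1) • vacA q k)
        - ∑ h : Box q with RightOf j h, modePsi k u h (-1) • modeE k i v (-1) • vacA q k)
      + ((∑ h : Box q with RightOf h i, modeE k u j (-1) • modePsi k h v (-1) • vacA q k)
        - ∑ h : Box q with RightOf v h, modeE k u j (-1) • modePsi k i h (-1) • vacA q k) := by
  rw [dZero_mode k u j (Fin.le_def.2 h.ge), incl_mode k i v (Fin.le_def.2 h'.ge), incl_vac,
    diffMode_same_col k u j h, dZero_modeB_same_col k i v h', smul_sub, Finset.smul_sum,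
    Finset.smul_sum]

/-! ### The quadratic part of `W⁽²⁾` -/

/-- The coefficient of `e_{u,j}[-1] e_{i,v}[-1]` in `W⁽²⁾`, where `u`, `v` lie in the row `w`,
`i`, `v` in the column `s`, and `u`, `j` in the column `t`; the height of the last column is `L`.
It is `1` if `w ≤ L`, `t < s`, it is `-1` if `w > L`, `t ≥ s`, and it is zero otherwise. -/
def quadCoeff (L w s t : ℕ) : ℂ := (if t < s then 1 else 0) - (if L < w then 1 else 0)

theorem quadCoeff_sub_succ_right (L w s t : ℕ) :
    quadCoeff L w s t - quadCoeff L w s (t + 1) = if t + 1 = s then 1 else 0 := by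
  unfold quadCoeff
  split_ifs <;> first | omega | simp

theorem quadCoeff_sub_succ_left (L w s t : ℕ) :
    quadCoeff L w s t - quadCoeff L w (s + 1) t = if s = t then -1 else 0 := by
  unfold quadCoeff
  split_ifs <;> first | omega | simp

/-- Summation by parts in the column of the left factor `e_{u,j}` leaves the terms in which `u` is in
the column of `v`, hence `u = v`. -/
theorem sum_quad_left (hq : Antitone q) (L p r : ℕ) (hr : 1 ≤ r) (hrL : ∀ s, r ≤ q s)
    (f : Box q → Box q → Box q → Box q → M) :
    (∑ i : Box q, ∑ j : Box q, ∑ u : Box q, ∑ v : Box q,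
      if row i = p ∧ row j = r ∧ col u = col j ∧ col i = col v ∧ row u = row v then
        quadCoeff L (row v) (col i) (col j) •
          ((∑ h : Box q with RightOf h u, f h j i v) - ∑ h : Box q with RightOf j h, f u h i v)
      else 0)
    = ∑ i : Box q, ∑ j : Box q, if row i = p ∧ row j = r ∧ (col i : ℕ) = col j + 1 then
        ∑ v : Box q with col v = col i, f v j i v else 0 := by
  have step : ∀ i v : Box q, (∑ j : Box q, ∑ u : Box q,
      if row i = p ∧ row j = r ∧ col u = col j ∧ col i = col v ∧ row u = row v then
        quadCoeff L (row v) (col i) (col j) •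
          ((∑ h : Box q with RightOf h u, f h j i v) - ∑ h : Box q with RightOf j h, f u h i v)
      else 0)
      = ∑ j : Box q, if (row i = p ∧ row j = r ∧ (col i : ℕ) = col j + 1) ∧ col v = col i then
        f v j i v else 0 := by
    intro i v
    have h := sum_rightOf_sub hq (row v) r 0 hr (fun t => quadCoeff L (row v) (col i) t)
      (fun s _ _ => hrL s) (fun u j => f u j i v)
    simp only [quadCoeff_sub_succ_right, add_zero, zero_add] at h
    rw [Finset.sum_comm]
    by_cases hiv : row i = p ∧ col i = col v
    · simp only [hiv.1, hiv.2, Fin.ext_iff, true_and] at h ⊢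
      refine Eq.trans (Finset.sum_congr rfl fun u _ => Finset.sum_congr rfl fun j _ =>
        if_congr (by tauto) rfl rfl) (h.trans ?_)
      rw [Finset.sum_comm]
      refine Finset.sum_congr rfl fun j _ => ?_
      -- Only `u = v` is left: both are in the same row, and in the column after that of `j`.
      simp only [ite_smul, one_smul, zero_smul, ← ite_and]
      rw [Finset.sum_eq_single v]
      · exact if_congr (by constructor <;> (intro h; grind)) rfl rfl
      · exact fun u _ hu => if_neg fun h' => hu (box_ext h'.1.1 (by omega))
      · simp
    · rw [Finset.sum_eq_zero, Finset.sum_eq_zero]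
      · exact fun j _ => if_neg fun h' => hiv ⟨h'.1.1, h'.2.symm⟩
      · exact fun u _ => Finset.sum_eq_zero fun j _ => if_neg fun h' => hiv ⟨h'.1, h'.2.2.2.1⟩
  refine Finset.sum_congr rfl fun i _ => ?_
  refine Finset.sum_comm_cycle.trans ?_
  rw [Finset.sum_congr rfl fun v _ => step i v, Finset.sum_comm]
  refine Finset.sum_congr rfl fun j _ => ?_
  simp only [ite_and (_ ∧ _), Finset.sum_ite_irrel, Finset.sum_const_zero, Finset.sum_filter]

/-- Summation by parts in the column of the right factor `e_{i,v}` leaves the terms in which `v` is in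
the column of `u`, hence `v = u`. -/
theorem sum_quad_right (hq : Antitone q) (L p r : ℕ) (hL : ∀ s, L ≤ q s)
    (f : Box q → Box q → Box q → Box q → M) :
    (∑ i : Box q, ∑ j : Box q, ∑ u : Box q, ∑ v : Box q,
      if row i = p ∧ row j = r ∧ col u = col j ∧ col i = col v ∧ row u = row v then
        quadCoeff L (row v) (col i) (col j) •
          ((∑ h : Box q with RightOf h i, f u j h v) - ∑ h : Box q with RightOf v h, f u j i h)
      else 0)
    = - ∑ i : Box q, ∑ j : Box q, if row i = p ∧ row j = r ∧ (col i : ℕ) = col j + 1 then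
        ∑ v : Box q with col v = col j, f v j i v else 0 := by
  have step : ∀ j u : Box q, (∑ i : Box q, ∑ v : Box q,
      if row i = p ∧ row j = r ∧ col u = col j ∧ col i = col v ∧ row u = row v then
        quadCoeff L (row v) (col i) (col j) •
          ((∑ h : Box q with RightOf h i, f u j h v) - ∑ h : Box q with RightOf v h, f u j i h)
      else 0)
      = ∑ i : Box q, if (row i = p ∧ row j = r ∧ (col i : ℕ) = col j + 1) ∧ col u = col j then
        - f u j i u else 0 := by
    intro j u
    by_cases hju : row j = r ∧ col u = col j
      -- If the row of `u` exceeds `L`, the coefficient vanishes for the columns beyond that of `u`;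
      -- the other columns contain this row.
    · have hc : ∀ s : Fin l, quadCoeff L (row u) s (col j) ≠ 0 → p ≤ q s → row u ≤ q s := by
        intro s hs _
        by_cases hu : row u ≤ L
        · exact hu.trans (hL s)
        · refine (row_le u).trans (hq (Fin.le_def.2 ?_))
          by_contra hsu
          refine hs ?_
          rw [quadCoeff, if_pos (by rw [← hju.2]; omega), if_pos (by omega), sub_self]
      have h := sum_rightOf_sub hq p (row u) 0 (by simp only [row]; omega)
        (fun s => quadCoeff L (row u) s (col j)) hc (fun i v => f u j i v)
      simp only [quadCoeff_sub_succ_left, add_zero, zero_add] at h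
      refine Eq.trans (Finset.sum_congr rfl fun i _ => Finset.sum_congr rfl fun v _ => ?_)
        (h.trans ?_)
      · by_cases hv : row i = p ∧ row v = row u ∧ (col i : ℕ) = col v
        · rw [if_pos ⟨hv.1, hju.1, hju.2, Fin.ext hv.2.2, hv.2.1.symm⟩, if_pos hv, hv.2.1, hv.2.2]
        · rw [if_neg hv, if_neg fun h' => hv ⟨h'.1, h'.2.2.2.2.symm, congrArg Fin.val h'.2.2.2.1⟩]
      · refine Finset.sum_congr rfl fun i _ => ?_
        simp only [ite_smul, neg_smul, one_smul, zero_smul, ← ite_and]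
        rw [Finset.sum_eq_single u]
        · exact if_congr (by rw [← hju.2]; tauto) rfl rfl
        · exact fun v _ hv => if_neg fun h' =>
            hv (box_ext h'.1.2.1 (h'.2.trans (congrArg Fin.val hju.2.symm)))
        · simp
    · rw [Finset.sum_eq_zero, Finset.sum_eq_zero]
      · exact fun i _ => if_neg fun h' => hju ⟨h'.1.2.1, h'.2⟩
      · exact fun i _ => Finset.sum_eq_zero fun v _ => if_neg fun h' => hju ⟨h'.2.1, h'.2.2.1⟩
  simp only [← Finset.sum_neg_distrib]
  refine Finset.sum_comm.trans (Eq.trans (Finset.sum_congr rfl fun j _ => ?_) Finset.sum_comm)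
  rw [Finset.sum_comm, Finset.sum_congr rfl fun u _ => step j u, Finset.sum_comm]
  refine Finset.sum_congr rfl fun i _ => ?_
  simp only [ite_and (_ ∧ _), Finset.sum_ite_irrel, Finset.sum_const_zero]
  rw [Finset.sum_filter]
  split_ifs
  · rw [← Finset.sum_neg_distrib]
    refine Finset.sum_congr rfl fun u _ => ?_
    split_ifs <;> simp
  · simp

/-! ### The elements `W⁽¹⁾` and `W⁽²⁾` are cocycles -/

variable (k : ℂ)

/-- The condition on `p`, `r` covers both `p = r` and rows `r` that meet every column. -/
theorem W1_mem (hq : Antitone q) (p r : ℕ) (hr : 1 ≤ r) (hpr : ∀ s, p ≤ q s → r ≤ q s) :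
    W1 q k p r ∈ WAlgebra q k := by
  have h := sum_rightOf_sub hq p r 0 hr (fun _ => 1) (fun s _ => hpr s)
    (fun i j => modePsi k i j (-1) • vacA q k)
  simp only [one_smul, sub_self, zero_smul, ite_self, Finset.sum_const_zero, add_zero] at h
  change dZero q k _ = 0
  simp only [W1, map_sum]
  rw [← h]
  refine Finset.sum_congr rfl fun i _ => Finset.sum_congr rfl fun j _ => ?_
  rw [apply_ite (dZero q k), map_zero]
  split_ifs with h1 h2 h2
  · exact dZero_modeB_same_col k i j h2.2.2 _
  · exact absurd ⟨h1.1, h1.2.1, congrArg Fin.val h1.2.2⟩ h2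
  · exact absurd ⟨h2.1, h2.2.1, Fin.ext h2.2.2⟩ h1
  · rfl

/-- `γ` extended to all natural numbers, so that `γ_{s+1}` makes sense for the last column `s`. -/
def gammaNat (q : Fin l → ℕ) (k : ℂ) (s : ℕ) : ℂ :=
  ∑ u ∈ Finset.univ.filter (fun u : Fin l => s < u), alpha q k u

theorem gammaNat_sub_succ (s : ℕ) (i : Fin l) (h : (i : ℕ) = s + 1) :
    gammaNat q k s - gammaNat q k (s + 1) = alpha q k i := by
  unfold gammaNat
  rw [Finset.sum_filter, Finset.sum_filter, ← Finset.sum_sub_distrib, Finset.sum_eq_single i]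
  · rw [if_pos (by omega), if_neg (by omega), sub_zero]
  · intro u _ hu
    have : (u : ℕ) ≠ s + 1 := fun h' => hu (Fin.ext (h'.trans h.symm))
    rw [if_congr (show s < (u : ℕ) ↔ s + 1 < (u : ℕ) by omega) rfl rfl, sub_self]
  · simp

/-- The quadratic terms of `W⁽²⁾`, with both kinds collected in one sum. -/
theorem W2_eq [NeZero l] (p r : ℕ) :
    W2 q k p r = (∑ i : Box q, ∑ j : Box q,
      if row i = p ∧ row j = r ∧ (col i : ℕ) = col j + 1 then modeB k i j (-1) • vacB q k else 0)
    - (∑ i : Box q, ∑ j : Box q, if row i = p ∧ row j = r ∧ col i = col j then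
        gamma q k (col i) • modeB k i j (-2) • vacB q k else 0)
    + ∑ i : Box q, ∑ j : Box q, ∑ u : Box q, ∑ v : Box q,
      if row i = p ∧ row j = r ∧ col u = col j ∧ col i = col v ∧ row u = row v then
        quadCoeff (q ⊤) (row v) (col i) (col j) • modeB k u j (-1) • modeB k i v (-1) • vacB q k
      else 0 := by
  rw [W2, add_sub_assoc]
  congr 1
  simp only [← Finset.sum_sub_distrib]
  refine Finset.sum_congr rfl fun i _ => Finset.sum_congr rfl fun j _ =>
    Finset.sum_congr rfl fun u _ => Finset.sum_congr rfl fun v _ => ?_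
  by_cases h : row i = p ∧ row j = r ∧ col u = col j ∧ col i = col v ∧ row u = row v
  · rw [if_pos h]
    obtain ⟨h1, h2, h3, h4, h5⟩ := h
    simp only [h1, h2, h3, h4, h5, true_and, quadCoeff, ← Fin.lt_def, ge_iff_le, gt_iff_lt,
      ← not_lt]
    by_cases ht : col j < col v <;> by_cases hw : q ⊤ < row v <;> simp [ht, hw]
  · rw [if_neg h, if_neg (by tauto), if_neg (by tauto), sub_zero]

theorem W2_mem [NeZero l] (hq : Antitone q) (p r : ℕ) (hr : 1 ≤ r) (hrL : r ≤ q ⊤) :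
    W2 q k p r ∈ WAlgebra q k := by
  have hL : ∀ s, q ⊤ ≤ q s := fun s => hq le_top
  have hA := sum_rightOf_sub hq p r 1 hr (fun _ => 1) (fun s _ _ => hrL.trans (hL s))
    (fun i j => modePsi k i j (-1) • vacA q k)
  simp only [one_smul, sub_self, zero_smul, ite_self, Finset.sum_const_zero] at hA
  have hB := sum_rightOf_sub hq p r 0 hr (gammaNat q k)
    (fun s _ _ => hrL.trans (hL s)) (fun i j => modePsi k i j (-2) • vacA q k)
  have hQ1 := sum_quad_left hq (q ⊤) p r hr (fun s => hrL.trans (hL s))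
    (fun u j i v => modePsi k u j (-1) • modeE k i v (-1) • vacA q k)
  have hQ2 := sum_quad_right hq (q ⊤) p r hL
    (fun u j i v => modeE k u j (-1) • modePsi k i v (-1) • vacA q k)
  have dA : dZero q k (∑ i : Box q, ∑ j : Box q,
      if row i = p ∧ row j = r ∧ (col i : ℕ) = col j + 1 then modeB k i j (-1) • vacB q k else 0)
      = (∑ i : Box q, ∑ j : Box q, if row i = p ∧ row j = r ∧ (col i : ℕ) = col j + 1 then
          ∑ v : Box q with col v = col j, modeE k v j (-1) • modePsi k i v (-1) • vacA q k else 0)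
        - (∑ i : Box q, ∑ j : Box q, if row i = p ∧ row j = r ∧ (col i : ℕ) = col j + 1 then
          ∑ v : Box q with col v = col i, modePsi k v j (-1) • modeE k i v (-1) • vacA q k else 0)
        + ∑ i : Box q, ∑ j : Box q, if row i = p ∧ row j = r ∧ (col i : ℕ) = col j + 1 then
          alpha q k (col i) • modePsi k i j (-2) • vacA q k else 0 := by
    refine Eq.trans ?_ (add_eq_left.2 hA)
    simp only [map_sum, ← Finset.sum_sub_distrib, ← Finset.sum_add_distrib]
    refine Finset.sum_congr rfl fun i _ => Finset.sum_congr rfl fun j _ => ?_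
    split_ifs with h
    · rw [dZero_modeB_vac k i j (Fin.le_def.2 (by omega)), diffMode_next_col k i j h.2.2]
    · simp
  have dB : dZero q k (∑ i : Box q, ∑ j : Box q, if row i = p ∧ row j = r ∧ col i = col j then
        gamma q k (col i) • modeB k i j (-2) • vacB q k else 0)
      = ∑ i : Box q, ∑ j : Box q, if row i = p ∧ row j = r ∧ (col i : ℕ) = col j + 1 then
          alpha q k (col i) • modePsi k i j (-2) • vacA q k else 0 := by
    refine Eq.trans ?_ (hB.trans ?_)
    · simp only [map_sum]
      refine Finset.sum_congr rfl fun i _ => Finset.sum_congr rfl fun j _ => ?_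
      by_cases h : row i = p ∧ row j = r ∧ col i = col j
      · rw [if_pos h, if_pos ⟨h.1, h.2.1, congrArg Fin.val h.2.2⟩, map_smul,
          dZero_modeB_same_col k i j (congrArg Fin.val h.2.2), h.2.2]
        rfl
      · rw [if_neg h, if_neg fun h' => h ⟨h'.1, h'.2.1, Fin.ext h'.2.2⟩, map_zero]
    · refine Finset.sum_congr rfl fun i _ => Finset.sum_congr rfl fun j _ => ?_
      split_ifs with h
      · rw [gammaNat_sub_succ k _ _ h.2.2]
      · rfl
  have dQ : dZero q k (∑ i : Box q, ∑ j : Box q, ∑ u : Box q, ∑ v : Box q,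
      if row i = p ∧ row j = r ∧ col u = col j ∧ col i = col v ∧ row u = row v then
        quadCoeff (q ⊤) (row v) (col i) (col j) • modeB k u j (-1) • modeB k i v (-1) • vacB q k
      else 0)
      = (∑ i : Box q, ∑ j : Box q, if row i = p ∧ row j = r ∧ (col i : ℕ) = col j + 1 then
          ∑ v : Box q with col v = col i, modePsi k v j (-1) • modeE k i v (-1) • vacA q k else 0)
        - ∑ i : Box q, ∑ j : Box q, if row i = p ∧ row j = r ∧ (col i : ℕ) = col j + 1 then
          ∑ v : Box q with col v = col j, modeE k v j (-1) • modePsi k i v (-1) • vacA q k else 0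
      := by
    rw [sub_eq_add_neg, ← hQ1, ← hQ2]
    simp only [map_sum, ← Finset.sum_add_distrib]
    refine Finset.sum_congr rfl fun i _ => Finset.sum_congr rfl fun j _ =>
      Finset.sum_congr rfl fun u _ => Finset.sum_congr rfl fun v _ => ?_
    split_ifs with h
    · rw [map_smul, dZero_modeB_modeB_same_col k u j i v (congrArg Fin.val h.2.2.1)
        (congrArg Fin.val h.2.2.2.1), smul_add]
    · simp
  change dZero q k _ = 0
  rw [W2_eq, map_add, map_sub, dA, dB, dQ]
  abel

end WAlg

theorem mainTheorem4 {l : ℕ} [NeZero l] (q : Fin l → ℕ) (hq : Antitone q) (k : ℂ) :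
    (∀ p r : ℕ, ((q ⊤ < p ∧ p = r ∧ p ≤ q ⊥) ∨ (1 ≤ p ∧ p ≤ q ⊤ ∧ 1 ≤ r ∧ r ≤ q ⊤)) →
      WAlg.W1 q k p r ∈ WAlg.WAlgebra q k) ∧
    (∀ p r : ℕ, 1 ≤ p → p ≤ q ⊤ → 1 ≤ r → r ≤ q ⊤ →
      WAlg.W2 q k p r ∈ WAlg.WAlgebra q k) := by
  refine ⟨fun p r h => ?_, fun p r _ _ hr hrL => WAlg.W2_mem k hq p r hr hrL⟩
  rcases h with ⟨hp, rfl, -⟩ | ⟨-, -, hr, hrL⟩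
  · exact WAlg.W1_mem k hq p p (by omega) fun _ h => h
  · exact WAlg.W1_mem k hq p r hr fun s _ => hrL.trans (hq le_top)
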